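/- **Conventions.** A $k$-graph $H$ is a finite vertex set $V(H)$ with a set $E(H)$ of $k$-element subsets of $V(H)$. Let $1\le \ell<k$. An *$\ell$-path* (of length $m$) is a $k$-graph whose $b=m(k-\ell)+\ell$ vertices can be listed as $v_1,\dots,v_b$ so that its edges are precisely the sets $\{v_{r(k-\ell)+1},\dots,v_{r(k-\ell)+k}\}$, $0\le r\le m-1$. An *$\ell$-cycle* is a $k$-graph which, for some $m\ge 1$, has $m(k-\ell)$ vertices that can be cyclically ordered as $v_1,\dots,v_{m(k-\ell)}$ so that its edges are precisely the sets $\{v_{r(k-\ell)+1},\dots,v_{r(k-\ell)+k}\}$, $0\le r\le m-1$ (indices modulo $m(k-\ell)$), and each edge meets the (cyclically) next one in exactly $\ell$ vertices. A path $P$ is a *path segment* of a cycle $C$ if $P$ is a subgraph of $C$. For $S,T\subseteq V(H)$, $\deg_H(S,T)$ is the number of edges $e\in E(H)$ with $S\subseteq e$ and $e\setminus S\subseteq T$. For $p\in[0,1]$, the *$p$-perturbation* $H_p^+$ is the random $k$-graph on $V(H)$ which contains every edge of $H$, and in which each $k$-subset of $V(H)$ that is not an edge of $H$ becomes an edge with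 probability $p$, independently of all others. **Lemma (connecting lemma).** For every integer $k$ and every $\alpha>0$ there is $\vartheta_0=\vartheta_0(k,\alpha)>0$ such that the following holds for all integers $\ell$ with $2\le\ell<k$, all real $c<1/t$, where $t:=\lceil k/(k-\ell)\rceil-1$, and all $0<\vartheta<\vartheta_0$. For every $\varepsilon>0$ there is $n_0$ such that, for every $n\ge n_0$: let $H$ be a $k$-graph on $n$ vertices, let $\mathcal P$ be a non-empty collection of at most $\vartheta n$ pairwise vertex-disjoint $\ell$-paths in $H$, and let $X:=V(H)\setminus\bigcup_{P\in\mathcal P}V(P)$. Suppose that $\deg_H(S,X)\ge\alpha n^{k-\ell}$ for every $\ell$-element set $S\subseteq V(H)$, and let $p\in[0,1]$ satisfy $p\ge n^{-(k-\ell)-c}$. Then with probability at least $1-\varepsilon$ there exists an $\ell$-cycle $C$ in $H_p^+$ such that $|V(C)\cap X|\le 4k|\mathcal P|$ and every $P\in\mathcal P$ is a path segment of $C$. -/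

import Mathlib

open scoped unitInterval

/-- A (finite) `k`-uniform hypergraph whose vertices are taken from the type `V`. -/
@[ext]
structure KGraph (V : Type*) (k : ℕ) where
  verts : Finset V
  edges : Finset (Finset V)
  edge_subset : ∀ e ∈ edges, e ⊆ verts
  edge_card : ∀ e ∈ edges, e.card = k

namespace KGraph

/-- `P` is a subgraph of `H`; "`P` is a path segment of `C`" means the same thing. -/
def IsSubgraph {V : Type*} {k : ℕ} (P H : KGraph V k) : Prop :=
  P.verts ⊆ H.verts ∧ P.edges ⊆ H.edges

/-- `deg_H(S, T)`: the number of edges `e` of `H` with `S ⊆ e` and `e \ S ⊆ T`. -/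
def deg {V : Type*} [DecidableEq V] {k : ℕ} (H : KGraph V k) (S T : Finset V) : ℕ :=
  (H.edges.filter (fun e => S ⊆ e ∧ e \ S ⊆ T)).card

/-- The `k`-sets of vertices of `H` which are not edges of `H`. -/
def nonEdges {V : Type*} [DecidableEq V] {k : ℕ} (H : KGraph V k) : Finset (Finset V) :=
  H.verts.powersetCard k \ H.edges

open Classical in
/-- The `k`-graph obtained from `H` by turning those non-edges of `H` that belong to `R` into
edges. If `R` contains each non-edge of `H` with probability `p`, independently of all others
(the law `ProbabilityTheory.setBernoulli H.nonEdges p`), this is the `p`-perturbation of `H`. -/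
noncomputable def perturb {V : Type*} [DecidableEq V] {k : ℕ} (H : KGraph V k)
    (R : Set (Finset V)) : KGraph V k where
  verts := H.verts
  edges := H.edges ∪ H.nonEdges.filter (fun e => e ∈ R)
  edge_subset := by
    intro e he
    rcases Finset.mem_union.1 he with h | h
    · exact H.edge_subset e h
    · exact (Finset.mem_powersetCard.1
        (Finset.mem_sdiff.1 (Finset.mem_filter.1 h).1).1).1
  edge_card := by
    intro e he
    rcases Finset.mem_union.1 he with h | h
    · exact H.edge_card e h
    · exact (Finset.mem_powersetCard.1
        (Finset.mem_sdiff.1 (Finset.mem_filter.1 h).1).1).2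

/-- `P` is an `ℓ`-path of length `m` with vertex sequence `v 0, …, v (b - 1)`, where
`b = m (k - ℓ) + ℓ`: these are distinct, they are the vertices of `P`, and the edges of `P` are
the sets `{v (r (k - ℓ)), …, v (r (k - ℓ) + k - 1)}` for `0 ≤ r < m`. -/
def IsPathSeq {V : Type*} [DecidableEq V] {k : ℕ} (P : KGraph V k) (ℓ m : ℕ) (v : ℕ → V) :
    Prop :=
  Set.InjOn v (Finset.range (m * (k - ℓ) + ℓ)) ∧
  P.verts = (Finset.range (m * (k - ℓ) + ℓ)).image v ∧
  P.edges = (Finset.range m).image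
    (fun r => (Finset.range k).image (fun j => v (r * (k - ℓ) + j)))

/-- `P` is an `ℓ`-path. -/
def IsPath {V : Type*} [DecidableEq V] {k : ℕ} (P : KGraph V k) (ℓ : ℕ) : Prop :=
  ∃ (m : ℕ) (v : ℕ → V), P.IsPathSeq ℓ m v

/-- The `r`-th set of `k` cyclically consecutive vertices, starting at position `r (k - ℓ)`, in
the cyclic ordering `v 0, …, v (m (k - ℓ) - 1)`. -/
def cycleEdge {V : Type*} [DecidableEq V] (k ℓ m : ℕ) (v : ℕ → V) (r : ℕ) : Finset V :=
  (Finset.range k).image (fun j => v ((r * (k - ℓ) + j) % (m * (k - ℓ))))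

/-- `C` is an `ℓ`-cycle: for some `m ≥ 1` it has `m (k - ℓ)` vertices, which can be cyclically
ordered so that its `m` edges are sets of `k` consecutive vertices, the start of each edge being
`k - ℓ` places after that of the previous one, and each edge meets the next one in exactly `ℓ`
vertices. -/
def IsCycle {V : Type*} [DecidableEq V] {k : ℕ} (C : KGraph V k) (ℓ : ℕ) : Prop :=
  ∃ (m : ℕ) (v : ℕ → V), 1 ≤ m ∧
    Set.InjOn v (Finset.range (m * (k - ℓ))) ∧
    C.verts = (Finset.range (m * (k - ℓ))).image v ∧
    C.edges = (Finset.range m).image (cycleEdge k ℓ m v) ∧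
    ∀ r < m, (cycleEdge k ℓ m v r ∩ cycleEdge k ℓ m v (r + 1)).card = ℓ

/-- The vertices of `H` not covered by the members of `Ps`. -/
def uncovered {V : Type*} [DecidableEq V] {k : ℕ} (H : KGraph V k)
    (Ps : Finset (KGraph V k)) : Finset V :=
  H.verts \ Ps.biUnion KGraph.verts

end KGraph

/-! Put d = k - ℓ, so that ℓ ≤ td < k. To connect the end S of one path to the start T of the next,
insert M = 3td - ℓ ≤ 3k vertices of X. This creates 3t windows, that is, blocks of k consecutive
positions starting at multiples of d. The degree condition, applied forward from S and backward from
T, yields at least a constant times n^M fillings whose first t and last t windows are edges of H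
(`exists_connections`). The middle t windows consist of new vertices only and are left to the random
edges.

The fillings of one connection have expected weight of order n^M p^t. Two fillings that share a > 0
middle windows have at least ℓ + ad vertices in common, so the relative variance is O(n^(-ℓ)
n^(c't)) with c' = max(c, 0) (`sum_not_disjoint_windowEdges_le`). Since ℓ ≥ 2 and c't < 1, even the
sum of these over up to n connections tends to 0.

Each connection must avoid the set W ⊆ X of vertices used before, where |W| ≤ Mϑn. No union bound
over W is needed. The same variance estimate is applied to the embeddings with one prescribed value
at one position, and the Cauchy–Schwarz inequality then bounds the weight that meets W for all such
W at once (`exists_avoiding_of_deviation_lt`). For small ϑ this is less than the weight available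
for any connection. So on a single likely event (`le_prob_exists_avoiding`) the connections can be
chosen greedily and closed up to a cycle (`KGraph.exists_cycle_of_connections`). -/

/-! ### Mean and variance of weights of a Bernoulli random set. -/

section SecondMoment

open MeasureTheory ProbabilityTheory

/-- The independent product formula for a Bernoulli random set. -/
theorem integral_setBernoulli_prod {ι : Type*} [Fintype ι] (u : Set ι) (p : I)
    (φ : ι → Prop → ℝ) :
    ∫ R, ∏ i, φ i (i ∈ R) ∂(setBernoulli u p)
      = ∏ i, ((p : ℝ) * φ i (i ∈ u) + (1 - p) * φ i False) := by
  have hm : Measurable (fun q : ι → Prop ↦ {i | q i}) := MeasurableEquiv.setOfPred.measurable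
  rw [setBernoulli_eq_map, Measure.infinitePi_eq_pi,
    integral_map hm.aemeasurable Measurable.of_discrete.aestronglyMeasurable]
  refine (integral_fintype_prod_eq_prod φ).trans (Finset.prod_congr rfl fun i _ => ?_)
  rw [integral_add_measure Integrable.of_finite Integrable.of_finite,
    integral_smul_nnreal_measure, integral_smul_nnreal_measure, integral_dirac, integral_dirac]
  rfl

/-- The weight of `i` in `R`: the indicator of `i ∈ R` if `i ∈ u`, and the constant `p`
otherwise. -/
noncomputable def presence {ι : Type*} (u : Set ι) (p : ℝ) (R : Set ι) (i : ι) : ℝ :=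
  open Classical in if i ∈ u then (if i ∈ R then 1 else 0) else p

theorem presence_nonneg {ι : Type*} (u : Set ι) {p : ℝ} (hp : 0 ≤ p) (R : Set ι) (i : ι) :
    0 ≤ presence u p R i := by
  unfold presence; split_ifs <;> simp [hp]

theorem mem_of_presence_ne_zero {ι : Type*} {u : Set ι} {p : ℝ} {R : Set ι} {i : ι}
    (h : presence u p R i ≠ 0) (hi : i ∈ u) : i ∈ R := by
  by_contra hR
  simp [presence, hi, hR] at h

/-- Giving weight p to the elements outside `u` makes the mean depend on `A.card` only, so windows
that are already edges of H need no separate treatment. -/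
theorem integral_prod_presence {ι : Type*} [Fintype ι] [DecidableEq ι] (u : Set ι) (p : I)
    (A : Finset ι) :
    ∫ R, ∏ i ∈ A, presence u p R i ∂(setBernoulli u p) = (p : ℝ) ^ A.card := by
  classical
  have h := integral_setBernoulli_prod u p
    (fun i P => if i ∈ A then (if i ∈ u then (if P then 1 else 0) else (p : ℝ)) else 1)
  have h1 : ∀ R : Set ι, ∏ i ∈ A, presence u p R i
      = ∏ i, (if i ∈ A then (if i ∈ u then (if i ∈ R then 1 else 0) else (p : ℝ)) else 1) := by
    intro R
    rw [Fintype.prod_ite_mem]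
    rfl
  have h2 : (p : ℝ) ^ A.card = ∏ i, if i ∈ A then (p : ℝ) else 1 := by
    rw [Fintype.prod_ite_mem, Finset.prod_const]
  simp_rw [h1, h, h2]
  refine Finset.prod_congr rfl fun i _ => ?_
  by_cases hA : i ∈ A <;> by_cases hu : i ∈ u <;> simp [hA, hu]
  ring

/-- Equality can fail only at elements of `A ∩ B` outside `u`, which contribute p² ≤ p. -/
theorem integral_prod_presence_mul_le {ι : Type*} [Fintype ι] [DecidableEq ι] (u : Set ι) (p : I)
    (A B : Finset ι) :
    ∫ R, (∏ i ∈ A, presence u p R i) * ∏ i ∈ B, presence u p R i ∂(setBernoulli u p)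
      ≤ (p : ℝ) ^ (A ∪ B).card := by
  classical
  have h := integral_setBernoulli_prod u p
    (fun i P => (if i ∈ A then (if i ∈ u then (if P then 1 else 0) else (p : ℝ)) else 1) *
      (if i ∈ B then (if i ∈ u then (if P then 1 else 0) else (p : ℝ)) else 1))
  have h1 : ∀ R : Set ι, (∏ i ∈ A, presence u p R i) * ∏ i ∈ B, presence u p R i
      = ∏ i, ((if i ∈ A then (if i ∈ u then (if i ∈ R then 1 else 0) else (p : ℝ)) else 1) *
        (if i ∈ B then (if i ∈ u then (if i ∈ R then 1 else 0) else (p : ℝ)) else 1)) := by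
    intro R
    rw [Finset.prod_mul_distrib, Fintype.prod_ite_mem, Fintype.prod_ite_mem]
    rfl
  have hp0 := p.2.1
  have hp1 := p.2.2
  have h2 : (p : ℝ) ^ (A ∪ B).card = ∏ i, if i ∈ A ∪ B then (p : ℝ) else 1 := by
    rw [Fintype.prod_ite_mem, Finset.prod_const]
  simp_rw [h1, h, h2]
  refine Finset.prod_le_prod (fun i _ => ?_) fun i _ => ?_
  · by_cases hA : i ∈ A <;> by_cases hB : i ∈ B <;> by_cases hu : i ∈ u <;>
      simp [hA, hB, hu] <;> nlinarith [mul_nonneg hp0 hp0]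
  · by_cases hA : i ∈ A <;> by_cases hB : i ∈ B <;> by_cases hu : i ∈ u <;>
      simp [hA, hB, hu] <;> nlinarith [mul_nonneg hp0 hp0]

/-- The total weight of the members of `G`, where `g` weighs as much as all of `E g` together. -/
noncomputable def weight {ι γ : Type*} (u : Set ι) (p : ℝ) (E : γ → Finset ι) (G : Finset γ)
    (R : Set ι) : ℝ :=
  ∑ g ∈ G, ∏ i ∈ E g, presence u p R i

theorem integral_weight {ι γ : Type*} [Fintype ι] [DecidableEq ι] (u : Set ι) (p : I)
    (E : γ → Finset ι) (G : Finset γ) (t : ℕ) (ht : ∀ g ∈ G, (E g).card = t) :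
    ∫ R, weight u p E G R ∂(setBernoulli u p) = G.card * (p : ℝ) ^ t := by
  unfold weight
  rw [integral_finsetSum _ fun _ _ => Integrable.of_finite,
    Finset.sum_congr rfl fun g hg => by rw [integral_prod_presence u p (E g), ht g hg]]
  simp

/-- A variance bound for the total weight: only pairs with a common element contribute. -/
theorem integral_weight_sub_sq_le {ι γ : Type*} [Fintype ι] [DecidableEq ι] (u : Set ι) (p : I)
    (E : γ → Finset ι) (G : Finset γ) (t : ℕ) (ht : ∀ g ∈ G, (E g).card = t) :
    ∫ R, (weight u p E G R - G.card * (p : ℝ) ^ t) ^ 2 ∂(setBernoulli u p)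
      ≤ ∑ g ∈ G, ∑ h ∈ G with ¬ Disjoint (E g) (E h), (p : ℝ) ^ (E g ∪ E h).card := by
  set m : ℝ := G.card * (p : ℝ) ^ t with hm
  have e1 : ∀ R, (weight u p E G R - m) ^ 2
      = weight u p E G R * weight u p E G R - (2 * m * weight u p E G R - m ^ 2) := by
    intro R; ring
  simp_rw [e1]
  rw [integral_sub Integrable.of_finite Integrable.of_finite,
    integral_sub Integrable.of_finite Integrable.of_finite, integral_const_mul,
    integral_weight u p E G t ht]
  have e2 : ∫ R, weight u p E G R * weight u p E G R ∂(setBernoulli u p)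
      ≤ ∑ g ∈ G, ∑ h ∈ G, (p : ℝ) ^ (E g ∪ E h).card := by
    unfold weight
    simp_rw [Finset.sum_mul_sum]
    rw [integral_finsetSum _ fun _ _ => Integrable.of_finite]
    refine Finset.sum_le_sum fun g _ => ?_
    rw [integral_finsetSum _ fun _ _ => Integrable.of_finite]
    exact Finset.sum_le_sum fun h _ => integral_prod_presence_mul_le u p (E g) (E h)
  -- A disjoint pair contributes exactly p^(2t), and p^(2t) summed over all pairs is the squared
  -- mean, which cancels.
  have e3 : ∑ g ∈ G, ∑ h ∈ G, (p : ℝ) ^ (E g ∪ E h).card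
      ≤ (∑ g ∈ G, ∑ h ∈ G with ¬ Disjoint (E g) (E h), (p : ℝ) ^ (E g ∪ E h).card) + m ^ 2 := by
    have : m ^ 2 = ∑ g ∈ G, ∑ h ∈ G, (p : ℝ) ^ (2 * t) := by
      rw [hm]; simp [mul_pow, ← pow_mul]; ring
    rw [this, ← Finset.sum_add_distrib]
    refine Finset.sum_le_sum fun g hg => ?_
    rw [← Finset.sum_filter_add_sum_filter_not G (fun h => ¬ Disjoint (E g) (E h))]
    refine add_le_add le_rfl ?_
    have hp0 : (0 : ℝ) ≤ p := p.2.1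
    refine (Finset.sum_le_sum (g := fun _ => (p : ℝ) ^ (2 * t)) fun h hh => ?_).trans
      (Finset.sum_le_sum_of_subset_of_nonneg (Finset.filter_subset _ _)
        fun _ _ _ => by positivity)
    rw [Finset.mem_filter, not_not] at hh
    rw [Finset.card_union_of_disjoint hh.2, ht g hg, ht h hh.1, two_mul]
  simp only [integral_const, probReal_univ, smul_eq_mul, one_mul]
  rw [← hm]
  nlinarith [e2, e3]

end SecondMoment

/-! ### Counting maps from a set of positions to vertices. -/

section Counting

variable {V : Type*}

/-- The maps sending `J` to `T` and everything else to `v₀`. -/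
noncomputable def mapsInto (J : Finset ℕ) (T : Finset V) (v₀ : V) : Finset (ℕ → V) :=
  open Classical in
  (J.pi fun _ => T).image fun φ j => if h : j ∈ J then φ j h else v₀

theorem mem_mapsInto {J : Finset ℕ} {T : Finset V} {v₀ : V} {f : ℕ → V} :
    f ∈ mapsInto J T v₀ ↔ (∀ j ∈ J, f j ∈ T) ∧ ∀ j ∉ J, f j = v₀ := by
  classical
  simp only [mapsInto, Finset.mem_image, Finset.mem_pi]
  constructor
  · rintro ⟨φ, hφ, rfl⟩
    exact ⟨fun j hj => by simpa [hj] using hφ j hj, fun j hj => by simp [hj]⟩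
  · rintro ⟨h1, h2⟩
    refine ⟨fun j _ => f j, h1, ?_⟩
    funext j
    by_cases hj : j ∈ J <;> simp [hj, h2]

theorem card_mapsInto (J : Finset ℕ) (T : Finset V) (v₀ : V) :
    (mapsInto J T v₀).card = T.card ^ J.card := by
  classical
  rw [mapsInto, Finset.card_image_of_injective, Finset.card_pi, Finset.prod_const]
  intro φ ψ h
  funext j hj
  simpa [hj] using congrFun h j

/-- A set of maps which are determined by their values on `J` has at most as many members as there
are choices for these values. -/
theorem card_le_prod_of_injOn_restrict {F : Finset (ℕ → V)} {J : Finset ℕ} {S : ℕ → Finset V}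
    (hS : ∀ f ∈ F, ∀ j ∈ J, f j ∈ S j)
    (hF : ∀ f ∈ F, ∀ g ∈ F, (∀ j ∈ J, f j = g j) → f = g) :
    F.card ≤ ∏ j ∈ J, (S j).card := by
  classical
  rw [← Finset.card_pi]
  refine Finset.card_le_card_of_injOn (fun f j _ => f j) (fun f hf => ?_) fun f hf g hg h => ?_
  · simpa using hS f hf
  · exact hF f hf g hg fun j hj => congrFun (congrFun h j) hj

theorem card_mapsInto_apply_eq_le [DecidableEq V] {J : Finset ℕ} {T : Finset V} {v₀ : V} {j : ℕ}
    (hj : j ∈ J) (v : V) {F : Finset (ℕ → V)} (hF : ∀ f ∈ F, f ∈ mapsInto J T v₀ ∧ f j = v) :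
    F.card ≤ T.card ^ (J.card - 1) := by
  refine (card_le_prod_of_injOn_restrict (J := J.erase j) (S := fun _ => T)
    (fun f hf i hi => ?_) fun f hf g hg h => ?_).trans ?_
  · exact (mem_mapsInto.1 (hF f hf).1).1 i (Finset.mem_of_mem_erase hi)
  · funext i
    by_cases hi : i = j
    · rw [hi, (hF f hf).2, (hF g hg).2]
    by_cases hi' : i ∈ J
    · exact h i (Finset.mem_erase.2 ⟨hi, hi'⟩)
    · rw [(mem_mapsInto.1 (hF f hf).1).2 i hi', (mem_mapsInto.1 (hF g hg).1).2 i hi']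
  · rw [Finset.prod_const, Finset.card_erase_of_mem hj]

theorem card_mapsInto_apply_eq_apply_le [DecidableEq V] {J : Finset ℕ} {T : Finset V} {v₀ : V}
    {i j : ℕ} (hi : i ∈ J) (hj : j ∈ J) (hij : i ≠ j) {F : Finset (ℕ → V)}
    (hF : ∀ f ∈ F, f ∈ mapsInto J T v₀ ∧ f i = f j) :
    F.card ≤ T.card ^ (J.card - 1) := by
  refine (card_le_prod_of_injOn_restrict (J := J.erase j) (S := fun _ => T)
    (fun f hf i hi => ?_) fun f hf g hg h => ?_).trans ?_
  · exact (mem_mapsInto.1 (hF f hf).1).1 i (Finset.mem_of_mem_erase hi)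
  · funext a
    by_cases ha : a = j
    · rw [ha, ← (hF f hf).2, ← (hF g hg).2]
      exact h i (Finset.mem_erase.2 ⟨hij, hi⟩)
    by_cases ha' : a ∈ J
    · exact h a (Finset.mem_erase.2 ⟨ha, ha'⟩)
    · rw [(mem_mapsInto.1 (hF f hf).1).2 a ha', (mem_mapsInto.1 (hF g hg).1).2 a ha']
  · rw [Finset.prod_const, Finset.card_erase_of_mem hj]

/-- Few maps from `J` to `T` are not injective on `J`. -/
theorem card_mapsInto_not_injOn_le [DecidableEq V] {J : Finset ℕ} {T : Finset V} {v₀ : V}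
    {F : Finset (ℕ → V)} (hF : ∀ f ∈ F, f ∈ mapsInto J T v₀ ∧ ¬ Set.InjOn f J) :
    F.card ≤ J.card ^ 2 * T.card ^ (J.card - 1) := by
  classical
  have h1 : F ⊆ J.offDiag.biUnion fun x => F.filter fun f => f x.1 = f x.2 := by
    intro f hf
    have := (hF f hf).2
    simp only [Set.InjOn, not_forall] at this
    obtain ⟨i, hi, j, hj, hij, hne⟩ := this
    exact Finset.mem_biUnion.2 ⟨(i, j), by simpa using ⟨hi, hj, hne⟩, by simp [hf, hij]⟩
  refine (Finset.card_le_card h1).trans ((Finset.card_biUnion_le_card_mul _ _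
    (T.card ^ (J.card - 1)) fun x hx => ?_).trans (Nat.mul_le_mul_right _ ?_))
  · rw [Finset.mem_offDiag] at hx
    refine card_mapsInto_apply_eq_apply_le (v₀ := v₀) hx.1 hx.2.1 hx.2.2 fun f hf => ?_
    rw [Finset.mem_filter] at hf
    exact ⟨(hF f hf.1).1, hf.2⟩
  · rw [Finset.offDiag_card, sq]
    exact Nat.sub_le _ _

/-- Few maps from `J` to `T` send a given part of `J` to a given small set. -/
theorem card_mapsInto_image_subset_le [DecidableEq V] {J J' : Finset ℕ} {T S : Finset V} {v₀ : V}
    (hJ : J' ⊆ J) {F : Finset (ℕ → V)}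
    (hF : ∀ f ∈ F, f ∈ mapsInto J T v₀ ∧ ∀ j ∈ J', f j ∈ S) :
    F.card ≤ S.card ^ J'.card * T.card ^ (J.card - J'.card) := by
  refine (card_le_prod_of_injOn_restrict (J := J) (S := fun j => if j ∈ J' then S else T)
    (fun f hf i hi => ?_) fun f hf g hg h => ?_).trans ?_
  · split_ifs with h
    · exact (hF f hf).2 i h
    · exact (mem_mapsInto.1 (hF f hf).1).1 i hi
  · funext a
    by_cases ha' : a ∈ J
    · exact h a ha'
    · rw [(mem_mapsInto.1 (hF f hf).1).2 a ha', (mem_mapsInto.1 (hF g hg).1).2 a ha']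
  · rw [← Finset.prod_sdiff hJ, mul_comm]
    refine Nat.mul_le_mul (le_of_eq ?_) (le_of_eq ?_)
    · rw [Finset.prod_congr rfl fun j hj => by rw [if_pos hj], Finset.prod_const]
    · rw [Finset.prod_congr rfl fun j hj => by rw [if_neg (Finset.mem_sdiff.1 hj).2],
        Finset.prod_const, Finset.card_sdiff_of_subset hJ]

end Counting

/-! ### Overlapping windows and the covariance sum. -/

section Windows

/-- The `r`-th window: `k` consecutive positions, starting at `r * d`. -/
def window (k d r : ℕ) : Finset ℕ := Finset.Ico (r * d) (r * d + k)

theorem mem_window {k d r j : ℕ} : j ∈ window k d r ↔ r * d ≤ j ∧ j < r * d + k := by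
  simp [window]

theorem card_window (k d r : ℕ) : (window k d r).card = k := by simp [window]

/-- One window has k positions, and each further window, taken in increasing order, has its last d
positions beyond all earlier ones. -/
theorem le_card_biUnion_window {k d : ℕ} (hdk : d ≤ k) (A : Finset ℕ) (hI : A.Nonempty) :
    (k - d) + A.card * d ≤ (A.biUnion (window k d)).card := by
  induction A using Finset.induction_on_max with
  | empty => exact absurd hI Finset.not_nonempty_empty
  | insert a s ha ih =>
    have has : a ∉ s := fun h => lt_irrefl _ (ha a h)
    rw [Finset.card_insert_of_notMem has, Finset.biUnion_insert]
    rcases s.eq_empty_or_nonempty with rfl | hs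
    · simp [card_window]; omega
    obtain ⟨b, hb⟩ := hs
    have hb1 : b + 1 ≤ a := ha b hb
    obtain ⟨a', rfl⟩ : ∃ a', a = a' + 1 := ⟨a - 1, by omega⟩
    have hdis : Disjoint (Finset.Ico (a' * d + k) (a' * d + k + d)) (s.biUnion (window k d)) := by
      rw [Finset.disjoint_right]
      intro x hx
      obtain ⟨c, hc, hx⟩ := Finset.mem_biUnion.1 hx
      have := (mem_window.1 hx).2
      have : c * d ≤ a' * d := Nat.mul_le_mul_right _ (Nat.lt_succ_iff.1 (ha c hc))
      simp only [Finset.mem_Ico]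
      omega
    have hsub : Finset.Ico (a' * d + k) (a' * d + k + d) ∪ s.biUnion (window k d)
        ⊆ window k d (a' + 1) ∪ s.biUnion (window k d) := by
      refine Finset.union_subset_union (fun x hx => ?_) subset_rfl
      rw [Finset.mem_Ico] at hx
      rw [mem_window, add_mul]
      omega
    have := Finset.card_le_card hsub
    rw [Finset.card_union_of_disjoint hdis, Nat.card_Ico] at this
    have := ih ⟨b, hb⟩
    rw [add_mul]
    omega

variable {V : Type*} [DecidableEq V]

/-- The images of the windows with index in `Q`. -/
def windowEdges (k d : ℕ) (Q : Finset ℕ) (g : ℕ → V) : Finset (Finset V) :=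
  Q.image fun r => (window k d r).image g

/-- If two windows have the same image, the first position of each lies in the other. -/
theorem injOn_window_image {k d : ℕ} (hd : 0 < d) (hk : 0 < k) {Q J : Finset ℕ}
    (hJ : ∀ r ∈ Q, window k d r ⊆ J) {g : ℕ → V} (hg : Set.InjOn g J) :
    Set.InjOn (fun r => (window k d r).image g) Q := by
  have key : ∀ r ∈ Q, ∀ r' ∈ Q, (window k d r).image g = (window k d r').image g → r' ≤ r := by
    intro r hr r' hr' h
    have h0 : r * d ∈ window k d r := mem_window.2 ⟨le_rfl, by omega⟩
    have h1 : g (r * d) ∈ (window k d r').image g := h ▸ Finset.mem_image_of_mem g h0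
    obtain ⟨j, hj, hjg⟩ := Finset.mem_image.1 h1
    have := hg (hJ r' hr' hj) (hJ r hr h0) hjg
    subst this
    exact Nat.le_of_mul_le_mul_right (mem_window.1 hj).1 hd
  intro r hr r' hr' h
  exact le_antisymm (key r' hr' r hr h.symm) (key r hr r' hr' h)

theorem card_windowEdges {k d : ℕ} (hd : 0 < d) (hk : 0 < k) {Q J : Finset ℕ}
    (hJ : ∀ r ∈ Q, window k d r ⊆ J) {g : ℕ → V} (hg : Set.InjOn g J) :
    (windowEdges k d Q g).card = Q.card :=
  Finset.card_image_of_injOn (injOn_window_image hd hk hJ hg)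

/-- For a fixed injective map `g`, the total weight of the injective maps that share a window image
with `g` is small. -/
theorem sum_not_disjoint_windowEdges_le {k d n : ℕ} (hd : 0 < d) (hdk : d ≤ k) {Q J : Finset ℕ}
    (hJ : ∀ r ∈ Q, window k d r ⊆ J) {T : Finset V} (hT : T.card = n) (hn : 0 < n) {v₀ : V}
    {p κ : ℝ} (hp : 0 < p) (hκ : 1 ≤ κ) (hpκ : 1 ≤ p * n ^ d * κ) {g : ℕ → V}
    (hg : Set.InjOn g J) {G : Finset (ℕ → V)}
    (hG : ∀ h ∈ G, h ∈ mapsInto J T v₀ ∧ Set.InjOn h J) :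
    ∑ h ∈ G with ¬ Disjoint (windowEdges k d Q g) (windowEdges k d Q h),
        p ^ (windowEdges k d Q g ∪ windowEdges k d Q h).card
      ≤ 2 ^ Q.card * J.card ^ J.card * p ^ (2 * Q.card) * n ^ (J.card - (k - d)) *
        κ ^ Q.card := by
  classical
  have hk : 0 < k := by omega
  have hn1 : (1 : ℝ) ≤ n := by exact_mod_cast hn
  set E := windowEdges k d Q g with hE
  -- The sum is split according to the set A of windows of h whose images also occur for g. The
  -- exponent of p depends only on |A|, and A is non-empty.
  set sh : (ℕ → V) → Finset ℕ := fun h => Q.filter fun r => (window k d r).image h ∈ E with hsh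
  set G' := G.filter fun h => ¬ Disjoint E (windowEdges k d Q h) with hG'
  have hmaps : ∀ h ∈ G', sh h ∈ Q.powerset.filter Finset.Nonempty := by
    intro h hh
    rw [Finset.mem_filter, Finset.mem_powerset]
    refine ⟨Finset.filter_subset _ _, ?_⟩
    obtain ⟨e, he1, he2⟩ := Finset.not_disjoint_iff.1 (Finset.mem_filter.1 hh).2
    obtain ⟨r, hr, rfl⟩ := Finset.mem_image.1 he2
    exact ⟨r, Finset.mem_filter.2 ⟨hr, he1⟩⟩
  have hcard : ∀ h ∈ G', (E ∪ windowEdges k d Q h).card = 2 * Q.card - (sh h).card := by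
    intro h hh
    have hinj := (hG h (Finset.mem_filter.1 hh).1).2
    have h1 : E ∩ windowEdges k d Q h = (sh h).image fun r => (window k d r).image h := by
      ext e
      simp only [windowEdges, Finset.mem_inter, Finset.mem_image, hsh, Finset.mem_filter]
      constructor
      · rintro ⟨h1, r, hr, rfl⟩
        exact ⟨r, ⟨hr, h1⟩, rfl⟩
      · rintro ⟨r, ⟨hr, h1⟩, rfl⟩
        exact ⟨h1, r, hr, rfl⟩
    have h2 : (E ∩ windowEdges k d Q h).card = (sh h).card := by
      rw [h1]
      exact Finset.card_image_of_injOn ((injOn_window_image hd hk hJ hinj).mono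
        (Finset.coe_subset.2 (Finset.filter_subset _ _)))
    rw [Finset.card_union, h2, hE, card_windowEdges hd hk hJ hg, card_windowEdges hd hk hJ hinj]
    omega
  rw [← Finset.sum_fiberwise_of_maps_to hmaps]
  have hterm : ∀ A ∈ Q.powerset.filter Finset.Nonempty,
      ∑ h ∈ G' with sh h = A, p ^ (E ∪ windowEdges k d Q h).card
        ≤ J.card ^ J.card * p ^ (2 * Q.card) * n ^ (J.card - (k - d)) * κ ^ Q.card := by
    intro A hI
    rw [Finset.mem_filter, Finset.mem_powerset] at hI
    obtain ⟨hIQ, hIne⟩ := hI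
    set J' := A.biUnion (window k d) with hJ'
    have hJ'J : J' ⊆ J := Finset.biUnion_subset.2 fun r hr => hJ r (hIQ hr)
    have hJcard := le_card_biUnion_window hdk A hIne
    rw [← hJ'] at hJcard
    have hJ'c := Finset.card_le_card hJ'J
    have hIc := Finset.card_le_card hIQ
    -- On the windows in A, h takes values in the image of g, which leaves at most |J| choices per
    -- position.
    have hcount : (G'.filter fun h => sh h = A).card
        ≤ J.card ^ J'.card * n ^ (J.card - J'.card) := by
      refine (card_mapsInto_image_subset_le (T := T) (S := J.image g) (v₀ := v₀) hJ'J
        fun f hf => ⟨?_, ?_⟩).trans ?_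
      · exact (hG f (Finset.mem_filter.1 (Finset.mem_filter.1 hf).1).1).1
      · intro j hj
        obtain ⟨r, hr, hjr⟩ := Finset.mem_biUnion.1 hj
        rw [Finset.mem_filter] at hf
        have : r ∈ sh f := hf.2 ▸ hr
        obtain ⟨r', hr', he⟩ := Finset.mem_image.1 (Finset.mem_filter.1 this).2
        have h3 : f j ∈ (window k d r').image g := he ▸ Finset.mem_image_of_mem f hjr
        exact Finset.image_subset_image (hJ r' hr') h3
      · rw [Finset.card_image_of_injOn hg, hT]
    have hJ0 : 0 < J.card := by
      obtain ⟨r, hr⟩ := hIne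
      exact Finset.card_pos.2 ⟨r * d, hJ r (hIQ hr) (mem_window.2 ⟨le_rfl, by omega⟩)⟩
    have hJ1 : (1 : ℝ) ≤ J.card := by exact_mod_cast hJ0
    have hcount' : ((G'.filter fun h => sh h = A).card : ℝ)
        ≤ J.card ^ J.card * n ^ (J.card - (k - d) - A.card * d) := by
      calc ((G'.filter fun h => sh h = A).card : ℝ)
          ≤ J.card ^ J'.card * n ^ (J.card - J'.card) := by exact_mod_cast hcount
        _ ≤ _ := mul_le_mul (pow_le_pow_right₀ hJ1 hJ'c) (pow_le_pow_right₀ hn1 (by omega))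
          (by positivity) (by positivity)
    have hsum : ∑ h ∈ G' with sh h = A, p ^ (E ∪ windowEdges k d Q h).card
        = (G'.filter fun h => sh h = A).card * p ^ (2 * Q.card - A.card) := by
      rw [Finset.sum_congr rfl fun h hh => ?_, Finset.sum_const, nsmul_eq_mul]
      rw [Finset.mem_filter] at hh
      rw [hcard h hh.1, hh.2]
    rw [hsum]
    -- Sharing the windows in A fixes at least (k - d) + |A|d positions and saves |A| factors p.
    -- Each (p n^d)⁻¹ is at most κ, and a factor n^(-(k - d)) is left as gain.
    have hone : (1 : ℝ) ≤ (p * n ^ d * κ) ^ A.card := one_le_pow₀ hpκ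
    have hκI : κ ^ A.card ≤ κ ^ Q.card := pow_le_pow_right₀ hκ hIc
    have e1 : p ^ (2 * Q.card) = p ^ (2 * Q.card - A.card) * p ^ A.card := by
      rw [← pow_add]; congr 1; omega
    have e2 : (n : ℝ) ^ (J.card - (k - d))
        = n ^ (J.card - (k - d) - A.card * d) * (n ^ d) ^ A.card := by
      rw [← pow_mul, ← pow_add]; congr 1; rw [mul_comm d]; omega
    calc ((G'.filter fun h => sh h = A).card : ℝ) * p ^ (2 * Q.card - A.card)
        ≤ (J.card ^ J.card * n ^ (J.card - (k - d) - A.card * d)) * p ^ (2 * Q.card - A.card) := by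
          gcongr
      _ ≤ (J.card ^ J.card * n ^ (J.card - (k - d) - A.card * d)) * p ^ (2 * Q.card - A.card) *
          (p * n ^ d * κ) ^ A.card := le_mul_of_one_le_right (by positivity) hone
      _ = J.card ^ J.card * p ^ (2 * Q.card) * n ^ (J.card - (k - d)) * κ ^ A.card := by
          rw [e1, e2, mul_pow, mul_pow]; ring
      _ ≤ _ := by gcongr
  refine (Finset.sum_le_card_nsmul _ _ _ hterm).trans ?_
  have hQ : ((Q.powerset.filter Finset.Nonempty).card : ℝ) ≤ 2 ^ Q.card := by
    have := Finset.card_le_card (Finset.filter_subset Finset.Nonempty Q.powerset)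
    rw [Finset.card_powerset] at this
    exact_mod_cast this
  rw [nsmul_eq_mul]
  calc _ ≤ (2 : ℝ) ^ Q.card *
        (J.card ^ J.card * p ^ (2 * Q.card) * n ^ (J.card - (k - d)) * κ ^ Q.card) := by gcongr
    _ = _ := by ring

end Windows

/-! ### The likely event: every connection can avoid every small set. -/

section GoodEvent

open MeasureTheory ProbabilityTheory

variable {V : Type*} [DecidableEq V]

/-- The maps from `J` to `T`, equal to `v₀` off `J`, which are injective on `J`. -/
noncomputable def embeddings (J : Finset ℕ) (T : Finset V) (v₀ : V) : Finset (ℕ → V) :=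
  open Classical in (mapsInto J T v₀).filter fun f => Set.InjOn f J

theorem mem_embeddings {J : Finset ℕ} {T : Finset V} {v₀ : V} {f : ℕ → V} :
    f ∈ embeddings J T v₀ ↔ f ∈ mapsInto J T v₀ ∧ Set.InjOn f J := by
  simp [embeddings]

/-- The squared deviations of the total weights of the families `F i`, together with those of the
families of all embeddings with one prescribed value. -/
noncomputable def deviation (k d : ℕ) (Q J : Finset ℕ) (T : Finset V) (v₀ : V)
    (u : Set (Finset V)) (p : ℝ) (q : ℕ) (F : ℕ → Finset (ℕ → V)) (R : Set (Finset V)) : ℝ :=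
  (∑ i ∈ Finset.range q,
      (weight u p (windowEdges k d Q) (F i) R - (F i).card * p ^ Q.card) ^ 2) +
    T.card * ∑ j ∈ J, ∑ v ∈ T,
      (weight u p (windowEdges k d Q) ((embeddings J T v₀).filter fun g => g j = v) R
        - ((embeddings J T v₀).filter fun g => g j = v).card * p ^ Q.card) ^ 2

theorem card_embeddings_filter_le {J : Finset ℕ} {T : Finset V} {v₀ : V} {j : ℕ} (hj : j ∈ J)
    (v : V) : ((embeddings J T v₀).filter fun g => g j = v).card ≤ T.card ^ (J.card - 1) :=
  card_mapsInto_apply_eq_le hj v fun f hf => by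
    rw [Finset.mem_filter, mem_embeddings] at hf
    exact ⟨hf.1.1, hf.2⟩

/-- Each variance carries a gain of n^(-(k - d)) ≤ n^(-2). One factor n pays for the at most n
families `F i`; the other is the `* n` on the left. The families with a prescribed value are smaller
by a factor n, which offsets the prefactor `T.card`. -/
theorem integral_deviation_le [Fintype V] {k d n : ℕ} (hd : 0 < d) (hdk : d + 2 ≤ k)
    {Q J : Finset ℕ} (hJ : ∀ r ∈ Q, window k d r ⊆ J) (hkJ : k ≤ J.card) {T : Finset V}
    (hT : T.card = n)
    (hn : 0 < n) (v₀ : V) (u : Set (Finset V)) (p : I) {κ : ℝ} (hp : 0 < (p : ℝ)) (hκ : 1 ≤ κ)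
    (hpκ : 1 ≤ (p : ℝ) * n ^ d * κ) {q : ℕ} (hq : q ≤ n) {F : ℕ → Finset (ℕ → V)}
    (hF : ∀ i < q, F i ⊆ embeddings J T v₀) :
    (∫ R, deviation k d Q J T v₀ u p q F R ∂(setBernoulli u p)) * n ≤
      (J.card + 1) * (2 ^ Q.card * J.card ^ J.card) * κ ^ Q.card *
        (n ^ J.card * (p : ℝ) ^ Q.card) ^ 2 := by
  have hk : 0 < k := by omega
  have hn1 : (1 : ℝ) ≤ n := by exact_mod_cast hn
  set B : ℝ := 2 ^ Q.card * J.card ^ J.card * (p : ℝ) ^ (2 * Q.card) * n ^ (J.card - (k - d)) *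
    κ ^ Q.card with hB
  have hB0 : 0 ≤ B := by positivity
  have hvar : ∀ G ⊆ embeddings J T v₀, ∫ R, (weight u p (windowEdges k d Q) G R
      - G.card * (p : ℝ) ^ Q.card) ^ 2 ∂(setBernoulli u p) ≤ G.card * B := by
    intro G hG
    refine (integral_weight_sub_sq_le u p _ G Q.card fun g hg =>
      card_windowEdges hd hk hJ (mem_embeddings.1 (hG hg)).2).trans ?_
    rw [← nsmul_eq_mul]
    refine Finset.sum_le_card_nsmul _ _ _ fun g hg => ?_
    exact sum_not_disjoint_windowEdges_le hd (by omega) hJ hT hn hp hκ hpκ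
      (mem_embeddings.1 (hG hg)).2 fun h hh => mem_embeddings.1 (hG hh)
  have hcard : ∀ G ⊆ embeddings J T v₀, (G.card : ℝ) ≤ n ^ J.card := by
    intro G hG
    have := Finset.card_le_card (hG.trans (Finset.filter_subset _ _))
    rw [card_mapsInto, hT] at this
    exact_mod_cast this
  have h1 : ∫ R, deviation k d Q J T v₀ u p q F R ∂(setBernoulli u p)
      ≤ n * (n ^ J.card * B) + n * (J.card * (n * (n ^ (J.card - 1) * B))) := by
    unfold deviation
    rw [integral_add Integrable.of_finite Integrable.of_finite, integral_const_mul,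
      integral_finsetSum _ fun _ _ => Integrable.of_finite,
      integral_finsetSum _ fun _ _ => Integrable.of_finite, hT]
    refine add_le_add ?_ (mul_le_mul_of_nonneg_left ?_ (by positivity))
    · calc _ ≤ ∑ i ∈ Finset.range q, (n : ℝ) ^ J.card * B := by
            refine Finset.sum_le_sum fun i hi => ?_
            have := hF i (Finset.mem_range.1 hi)
            exact (hvar _ this).trans (mul_le_mul_of_nonneg_right (hcard _ this) hB0)
        _ = q * (n ^ J.card * B) := by simp
        _ ≤ _ := by gcongr
    · calc _ ≤ ∑ j ∈ J, ((n : ℝ) * (n ^ (J.card - 1) * B)) := by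
            refine Finset.sum_le_sum fun j hj => ?_
            rw [integral_finsetSum _ fun _ _ => Integrable.of_finite]
            refine (Finset.sum_le_card_nsmul _ _ ((n : ℝ) ^ (J.card - 1) * B) fun v _ => ?_).trans
              (by rw [nsmul_eq_mul, hT])
            refine (hvar _ (Finset.filter_subset _ _)).trans ?_
            have := card_embeddings_filter_le (T := T) (v₀ := v₀) hj v
            rw [hT] at this
            gcongr
            exact_mod_cast this
        _ = _ := by simp
  have e1 : (n : ℝ) ^ J.card = n * n ^ (J.card - 1) := by
    rw [← pow_succ']; congr 1; omega
  -- Here `d + 2 ≤ k`, that is ℓ ≥ 2, is spent; `k ≤ J.card` prevents the subtraction from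
  -- truncating.
  have e2 : (n : ℝ) ^ (J.card - (k - d)) * n * n ≤ n ^ J.card := by
    rw [← pow_succ, ← pow_succ]
    exact pow_le_pow_right₀ hn1 (by omega)
  calc _ ≤ (n * (n ^ J.card * B) + n * (J.card * (n * (n ^ (J.card - 1) * B)))) * n := by gcongr
    _ = (J.card + 1) * n ^ J.card * (B * n * n) := by rw [e1]; ring
    _ = (J.card + 1) * n ^ J.card * (2 ^ Q.card * J.card ^ J.card * (p : ℝ) ^ (2 * Q.card) *
        (n ^ (J.card - (k - d)) * n * n) * κ ^ Q.card) := by rw [hB]; ring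
    _ ≤ (J.card + 1) * n ^ J.card * (2 ^ Q.card * J.card ^ J.card * (p : ℝ) ^ (2 * Q.card) *
        n ^ J.card * κ ^ Q.card) := by gcongr
    _ = _ := by ring

/-- If the deviation is small, every small set `W` is avoided by a member of each large family
`F i` all whose window images have positive weight. -/
theorem exists_avoiding_of_deviation_lt {k d n : ℕ} {Q J : Finset ℕ} {T : Finset V}
    (hJ0 : 0 < J.card) (hT : T.card = n) (v₀ : V) (u : Set (Finset V)) {p : ℝ} (hp : 0 < p)
    (hn : 0 < n)
    {q : ℕ} {F : ℕ → Finset (ℕ → V)} (hF : ∀ i < q, F i ⊆ embeddings J T v₀) {γ s ω : ℝ}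
    (hs : 0 < s) (hγ : s + J.card * (ω + s) < γ)
    (hFc : ∀ i < q, γ * n ^ J.card ≤ (F i).card) {R : Set (Finset V)}
    (hR : deviation k d Q J T v₀ u p q F R < (s * (n ^ J.card * p ^ Q.card)) ^ 2)
    {i : ℕ} (hi : i < q) {W : Finset V} (hWT : W ⊆ T) (hW : (W.card : ℝ) ≤ ω * n) :
    ∃ g ∈ F i, (∀ j ∈ J, g j ∉ W) ∧ ∀ e ∈ windowEdges k d Q g, presence u p R e ≠ 0 := by
  set μ : ℝ := n ^ J.card * p ^ Q.card with hμ
  have hμ0 : 0 < μ := by positivity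
  set N := fun G => weight u p (windowEdges k d Q) G R with hN
  set Rt := fun (j : ℕ) (v : V) => (embeddings J T v₀).filter fun g => g j = v with hRt
  set D := fun (j : ℕ) (v : V) => N (Rt j v) - (Rt j v).card * p ^ Q.card with hD
  have hdev : deviation k d Q J T v₀ u p q F R
      = (∑ i ∈ Finset.range q, (N (F i) - (F i).card * p ^ Q.card) ^ 2) +
        T.card * ∑ j ∈ J, ∑ v ∈ T, D j v ^ 2 := rfl
  have hA0 : 0 ≤ ∑ i ∈ Finset.range q, (N (F i) - (F i).card * p ^ Q.card) ^ 2 :=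
    Finset.sum_nonneg fun _ _ => sq_nonneg _
  have hB0 : 0 ≤ (T.card : ℝ) * ∑ j ∈ J, ∑ v ∈ T, D j v ^ 2 :=
    mul_nonneg (by positivity) (Finset.sum_nonneg fun _ _ => Finset.sum_nonneg fun _ _ =>
      sq_nonneg _)
  have hlow : (γ - s) * μ ≤ N (F i) := by
    have h1 : (N (F i) - (F i).card * p ^ Q.card) ^ 2
        ≤ ∑ i ∈ Finset.range q, (N (F i) - (F i).card * p ^ Q.card) ^ 2 :=
      Finset.single_le_sum (f := fun i => (N (F i) - (F i).card * p ^ Q.card) ^ 2)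
        (fun _ _ => sq_nonneg _) (Finset.mem_range.2 hi)
    have h2 : (N (F i) - (F i).card * p ^ Q.card) ^ 2 < (s * μ) ^ 2 := by linarith
    have h3 := (abs_lt_of_sq_lt_sq' h2 (by positivity)).1
    have h4 : γ * n ^ J.card * p ^ Q.card ≤ (F i).card * p ^ Q.card :=
      mul_le_mul_of_nonneg_right (hFc i hi) (by positivity)
    have h5 : γ * n ^ J.card * p ^ Q.card = γ * μ := by rw [hμ]; ring
    linarith
  have hcol : ∀ j ∈ J, ∑ w ∈ W, N (Rt j w) ≤ (ω + s) * μ := by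
    intro j hj
    -- Cauchy–Schwarz bounds the total deviation over W by a quantity that does not depend on W;
    -- this is why `deviation` has the factor `T.card`.
    have h1 : (∑ w ∈ W, D j w) ^ 2 < (s * μ) ^ 2 := by
      calc (∑ w ∈ W, D j w) ^ 2 ≤ W.card * ∑ w ∈ W, D j w ^ 2 := sq_sum_le_card_mul_sum_sq
        _ ≤ T.card * ∑ j ∈ J, ∑ v ∈ T, D j v ^ 2 := by
          refine mul_le_mul (by exact_mod_cast Finset.card_le_card hWT) ?_
            (Finset.sum_nonneg fun _ _ => sq_nonneg _) (by positivity)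
          refine (Finset.sum_le_sum_of_subset_of_nonneg hWT fun _ _ _ => sq_nonneg _).trans ?_
          exact Finset.single_le_sum (f := fun j => ∑ v ∈ T, D j v ^ 2)
            (fun _ _ => Finset.sum_nonneg fun _ _ => sq_nonneg _) hj
        _ < _ := by linarith
    have h2 := (abs_lt_of_sq_lt_sq' h1 (by positivity)).2
    have h3 : ∑ w ∈ W, D j w = ∑ w ∈ W, N (Rt j w) - ∑ w ∈ W, (Rt j w).card * p ^ Q.card := by
      rw [← Finset.sum_sub_distrib]
    have h4 : ∑ w ∈ W, ((Rt j w).card : ℝ) * p ^ Q.card ≤ ω * μ := by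
      calc ∑ w ∈ W, ((Rt j w).card : ℝ) * p ^ Q.card
          ≤ ∑ w ∈ W, (n : ℝ) ^ (J.card - 1) * p ^ Q.card := by
            refine Finset.sum_le_sum fun w _ => ?_
            have := card_embeddings_filter_le (T := T) (v₀ := v₀) hj w
            rw [hT] at this
            refine mul_le_mul_of_nonneg_right ?_ (by positivity)
            exact_mod_cast this
        _ = W.card * ((n : ℝ) ^ (J.card - 1) * p ^ Q.card) := by simp
        _ ≤ (ω * n) * ((n : ℝ) ^ (J.card - 1) * p ^ Q.card) := by gcongr
        _ = ω * (n ^ (J.card - 1 + 1) * p ^ Q.card) := by rw [pow_succ]; ring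
        _ = ω * μ := by rw [Nat.sub_add_cancel hJ0]
    linarith
  -- Otherwise every member of `F i` with non-zero weight meets W, so the weight of `F i` is at most
  -- that of the embeddings with some value in W, which is too small.
  by_contra hcon
  push Not at hcon
  have hup : N (F i) ≤ ∑ j ∈ J, ∑ w ∈ W, N (Rt j w) := by
    have hY0 : ∀ g, 0 ≤ ∏ e ∈ windowEdges k d Q g, presence u p R e := fun g =>
      Finset.prod_nonneg fun e _ => presence_nonneg u hp.le R e
    have h1 : ∀ g ∈ F i, ∏ e ∈ windowEdges k d Q g, presence u p R e
        ≤ ∑ j ∈ J, ∑ w ∈ W, if g j = w then ∏ e ∈ windowEdges k d Q g, presence u p R e else 0 := by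
      intro g hg
      have hnn : ∀ j ∈ J, 0 ≤ ∑ w ∈ W,
          if g j = w then ∏ e ∈ windowEdges k d Q g, presence u p R e else 0 :=
        fun j _ => Finset.sum_nonneg fun w _ => by split_ifs; exacts [hY0 g, le_rfl]
      by_cases hav : ∀ j ∈ J, g j ∉ W
      · obtain ⟨e, he, he0⟩ := hcon g hg hav
        rw [Finset.prod_eq_zero he he0]
        simp
      · push Not at hav
        obtain ⟨j, hj, hjW⟩ := hav
        refine le_trans ?_ (Finset.single_le_sum hnn hj)
        simp [hjW]
    calc N (F i) ≤ ∑ g ∈ F i, ∑ j ∈ J, ∑ w ∈ W,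
          if g j = w then ∏ e ∈ windowEdges k d Q g, presence u p R e else 0 :=
          Finset.sum_le_sum h1
      _ ≤ ∑ g ∈ embeddings J T v₀, ∑ j ∈ J, ∑ w ∈ W,
          if g j = w then ∏ e ∈ windowEdges k d Q g, presence u p R e else 0 := by
          refine Finset.sum_le_sum_of_subset_of_nonneg (hF i hi) fun g _ _ => ?_
          exact Finset.sum_nonneg fun j _ => Finset.sum_nonneg fun w _ => by
            split_ifs; exacts [hY0 g, le_rfl]
      _ = _ := by
          rw [Finset.sum_comm]
          refine Finset.sum_congr rfl fun j _ => ?_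
          rw [Finset.sum_comm]
          refine Finset.sum_congr rfl fun w _ => ?_
          rw [← Finset.sum_filter]
          rfl
  have h6 : ∑ j ∈ J, ∑ w ∈ W, N (Rt j w) ≤ J.card * ((ω + s) * μ) := by
    rw [← nsmul_eq_mul]
    exact Finset.sum_le_card_nsmul _ _ _ hcol
  have h7 : (s + J.card * (ω + s)) * μ < γ * μ := mul_lt_mul_of_pos_right hγ hμ0
  nlinarith

/-- With high probability, every small set `W` is avoided by a member of each large family `F i`
all whose window images have positive weight. -/
theorem le_prob_exists_avoiding [Fintype V] {k d n : ℕ} (hd : 0 < d) (hdk : d + 2 ≤ k)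
    {Q J : Finset ℕ} (hJ : ∀ r ∈ Q, window k d r ⊆ J) (hkJ : k ≤ J.card) {T : Finset V}
    (hT : T.card = n) (hn : 0 < n) (v₀ : V) (u : Set (Finset V)) (p : I) {κ : ℝ}
    (hp : 0 < (p : ℝ)) (hκ : 1 ≤ κ) (hpκ : 1 ≤ (p : ℝ) * n ^ d * κ) {q : ℕ} (hq : q ≤ n)
    {F : ℕ → Finset (ℕ → V)} (hF : ∀ i < q, F i ⊆ embeddings J T v₀) {γ s ω : ℝ}
    (hs : 0 < s) (hγ : s + J.card * (ω + s) < γ)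
    (hFc : ∀ i < q, γ * n ^ J.card ≤ (F i).card) :
    1 - (J.card + 1) * (2 ^ Q.card * J.card ^ J.card) * κ ^ Q.card / (s ^ 2 * n)
      ≤ (setBernoulli u p).real {R | ∀ i < q, ∀ W ⊆ T, (W.card : ℝ) ≤ ω * n →
        ∃ g ∈ F i, (∀ j ∈ J, g j ∉ W) ∧ ∀ e ∈ windowEdges k d Q g, presence u p R e ≠ 0} := by
  set μ : ℝ := n ^ J.card * (p : ℝ) ^ Q.card with hμ
  have hμ0 : 0 < μ := by positivity
  set Z := deviation k d Q J T v₀ u p q F with hZ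
  have hZ0 : ∀ R, 0 ≤ Z R := fun R =>
    add_nonneg (Finset.sum_nonneg fun _ _ => sq_nonneg _) (mul_nonneg (by positivity)
      (Finset.sum_nonneg fun _ _ => Finset.sum_nonneg fun _ _ => sq_nonneg _))
  have hint := integral_deviation_le hd hdk hJ hkJ hT hn v₀ u p hp hκ hpκ hq hF
  -- Markov's inequality is used once, for the deviation; the resulting event serves all i and all
  -- W.
  have hmarkov := mul_meas_ge_le_integral_of_nonneg (μ := setBernoulli u p) (f := Z)
    (Filter.Eventually.of_forall hZ0) Integrable.of_finite ((s * μ) ^ 2)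
  have hbad : (setBernoulli u p).real {R | (s * μ) ^ 2 ≤ Z R}
      ≤ (J.card + 1) * (2 ^ Q.card * J.card ^ J.card) * κ ^ Q.card / (s ^ 2 * n) := by
    rw [le_div_iff₀ (by positivity)]
    refine le_of_mul_le_mul_right ?_ (by positivity : 0 < μ ^ 2)
    calc _ = ((s * μ) ^ 2 * (setBernoulli u p).real {R | (s * μ) ^ 2 ≤ Z R}) * n := by ring
      _ ≤ (∫ R, Z R ∂(setBernoulli u p)) * n := by gcongr
      _ ≤ _ := hint
  have hcompl : (setBernoulli u p).real {R | (s * μ) ^ 2 ≤ Z R}ᶜ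
      = 1 - (setBernoulli u p).real {R | (s * μ) ^ 2 ≤ Z R} :=
    probReal_compl_eq_one_sub (MeasurableSet.of_discrete)
  calc _ ≤ (setBernoulli u p).real {R | (s * μ) ^ 2 ≤ Z R}ᶜ := by rw [hcompl]; linarith
    _ ≤ _ := by
      refine measureReal_mono (fun R hR => ?_)
      rw [Set.mem_compl_iff, Set.mem_ofPred_eq, not_le] at hR
      exact fun i hi W hWT hW =>
        exists_avoiding_of_deviation_lt (by omega) hT v₀ u hp hn hF hs hγ hFc hR hi hWT hW

end GoodEvent

/-! ### Many connections from the degree condition. -/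

section Extension

variable {V : Type*}

/-- If every member of `A` has at least `κ` extensions to `B`, there are at least `κ * A.card`
extended maps. -/
theorem exists_extension_family [DecidableEq V] {A : Finset (ℕ → V)} {D B : Finset ℕ}
    (hDB : Disjoint D B)
    {X : Finset V} {v₀ : V} (hA : A ⊆ mapsInto D X v₀) {E : (ℕ → V) → Finset (ℕ → V)}
    (hE : ∀ f ∈ A, E f ⊆ mapsInto B X v₀) {κ : ℝ} (hκ : ∀ f ∈ A, κ ≤ (E f).card) :
    ∃ A' ⊆ mapsInto (D ∪ B) X v₀, κ * A.card ≤ A'.card ∧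
      ∀ h ∈ A', ∃ f ∈ A, ∃ ψ ∈ E f, (∀ j ∉ B, h j = f j) ∧ ∀ j ∈ B, h j = ψ j := by
  classical
  -- The pair (f, ψ) can be recovered from the combined map, since D and B are disjoint and each map
  -- is constantly v₀ off its own domain.
  refine ⟨(A.sigma E).image fun x => B.piecewise x.2 x.1, ?_, ?_, ?_⟩
  · intro h hh
    obtain ⟨⟨f, ψ⟩, hx, rfl⟩ := Finset.mem_image.1 hh
    rw [Finset.mem_sigma] at hx
    have hf := mem_mapsInto.1 (hA hx.1)
    have hψ := mem_mapsInto.1 (hE f hx.1 hx.2)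
    refine mem_mapsInto.2 ⟨fun j hj => ?_, fun j hj => ?_⟩
    · by_cases hjB : j ∈ B
      · simpa [hjB] using hψ.1 j hjB
      · simpa [hjB] using hf.1 j (by simpa [hjB] using hj)
    · rw [Finset.mem_union, not_or] at hj
      simpa [hj.2] using hf.2 j hj.1
  · rw [Finset.card_image_of_injOn, Finset.card_sigma, Nat.cast_sum, mul_comm, ← nsmul_eq_mul]
    · exact Finset.card_nsmul_le_sum _ _ _ hκ
    · rintro ⟨f, ψ⟩ hx ⟨f', ψ'⟩ hx' h
      simp only [Finset.coe_sigma, Set.mem_sigma_iff, Finset.mem_coe] at hx hx'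
      have hf := mem_mapsInto.1 (hA hx.1)
      have hf' := mem_mapsInto.1 (hA hx'.1)
      have hψ := mem_mapsInto.1 (hE f hx.1 hx.2)
      have hψ' := mem_mapsInto.1 (hE f' hx'.1 hx'.2)
      have e1 : f = f' := by
        funext j
        by_cases hjB : j ∈ B
        · rw [hf.2 j (Finset.disjoint_right.1 hDB hjB), hf'.2 j (Finset.disjoint_right.1 hDB hjB)]
        · simpa [hjB] using congrFun h j
      have e2 : ψ = ψ' := by
        funext j
        by_cases hjB : j ∈ B
        · simpa [hjB] using congrFun h j
        · rw [hψ.2 j hjB, hψ'.2 j hjB]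
      rw [e1, e2]
  · intro h hh
    obtain ⟨⟨f, ψ⟩, hx, rfl⟩ := Finset.mem_image.1 hh
    rw [Finset.mem_sigma] at hx
    exact ⟨f, hx.1, ψ, hx.2, fun j hj => by simp [hj], fun j hj => by simp [hj]⟩

variable [DecidableEq V] {k : ℕ}

/-- A set `S` can be completed to an edge in at least `H.deg S X` ways. -/
theorem KGraph.exists_edge_extensions (H : KGraph V k) {S X : Finset V} {B : Finset ℕ}
    (hB : S.card + B.card = k) (v₀ : V) :
    ∃ E ⊆ mapsInto B X v₀, H.deg S X ≤ E.card ∧ ∀ ψ ∈ E, S ∪ B.image ψ ∈ H.edges := by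
  classical
  -- One bijection from B to e \ S per edge e is enough: different edges give different maps.
  have key : ∀ e : Finset V, ∃ ψ : ℕ → V, (e ∈ H.edges ∧ S ⊆ e ∧ e \ S ⊆ X) →
      ψ ∈ mapsInto B X v₀ ∧ B.image ψ = e \ S := by
    intro e
    by_cases he : e ∈ H.edges ∧ S ⊆ e ∧ e \ S ⊆ X
    · have hc : B.card = (e \ S).card := by
        rw [Finset.card_sdiff_of_subset he.2.1, H.edge_card e he.1]; omega
      let φ := Finset.equivOfCardEq hc
      refine ⟨fun j => if h : j ∈ B then φ ⟨j, h⟩ else v₀, fun _ => ⟨mem_mapsInto.2 ⟨?_, ?_⟩, ?_⟩⟩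
      · intro j hj
        simpa [hj] using he.2.2 (φ ⟨j, hj⟩).2
      · intro j hj
        simp [hj]
      · ext v
        rw [Finset.mem_image]
        constructor
        · rintro ⟨j, hj, rfl⟩
          simpa only [hj, dif_pos] using (φ ⟨j, hj⟩).2
        · intro hv
          refine ⟨φ.symm ⟨v, hv⟩, (φ.symm ⟨v, hv⟩).2, ?_⟩
          simp
    · exact ⟨fun _ => v₀, fun h => absurd h he⟩
  choose ψ hψ using key
  refine ⟨(H.edges.filter fun e => S ⊆ e ∧ e \ S ⊆ X).image ψ, ?_, ?_, ?_⟩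
  · intro f hf
    obtain ⟨e, he, rfl⟩ := Finset.mem_image.1 hf
    exact (hψ e (Finset.mem_filter.1 he)).1
  · rw [Finset.card_image_of_injOn]
    · rfl
    · intro e he e' he' h
      rw [Finset.mem_coe, Finset.mem_filter] at he he'
      have h1 := (hψ e he).2
      have h2 := (hψ e' he').2
      rw [← Finset.union_sdiff_of_subset he.2.1, ← Finset.union_sdiff_of_subset he'.2.1,
        ← h1, ← h2, h]
  · intro f hf
    obtain ⟨e, he, rfl⟩ := Finset.mem_image.1 hf
    rw [Finset.mem_filter] at he
    rw [(hψ e he).2, Finset.union_sdiff_of_subset he.2.1]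
    exact he.1

/-- Serves to deduce from the degree condition that X has linear size. -/
theorem KGraph.deg_le_card_pow (H : KGraph V k) (S X : Finset V) :
    H.deg S X ≤ X.card ^ (k - S.card) := by
  refine le_trans ?_ (Nat.choose_le_pow X.card (k - S.card))
  rw [← Finset.card_powersetCard]
  refine Finset.card_le_card_of_injOn (fun e => e \ S) (fun e he => ?_) fun e he e' he' h => ?_
  · rw [Finset.mem_coe, Finset.mem_filter] at he
    refine Finset.mem_coe.2 (Finset.mem_powersetCard.2 ⟨he.2.2, ?_⟩)
    rw [Finset.card_sdiff_of_subset he.2.1, H.edge_card e he.1]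
  · rw [Finset.mem_coe, Finset.mem_filter] at he he'
    rw [← Finset.union_sdiff_of_subset he.2.1, ← Finset.union_sdiff_of_subset he'.2.1]
    exact congrArg (S ∪ ·) h

/-- The sequence `S 0, …, S (ℓ - 1), f ℓ, …, f (L - 1), T 0, T 1, …`. -/
def glue (ℓ L : ℕ) (S T f : ℕ → V) (j : ℕ) : V :=
  if j < ℓ then S j else if j < L then f j else T (j - L)

/-- There are at least `a` maps from `D` to `X` such that, placed between `S` and `T`, they turn the
windows with index in `Q` into edges of `H`. -/
def HasManyConnections (H : KGraph V k) (d ℓ L : ℕ) (S T : ℕ → V) (X : Finset V) (v₀ : V)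
    (D Q : Finset ℕ) (a : ℝ) : Prop :=
  ∃ A ⊆ mapsInto D X v₀, a ≤ A.card ∧
    ∀ f ∈ A, ∀ r ∈ Q, (window k d r).image (glue ℓ L S T f) ∈ H.edges

/-- An edge has k elements, so z is injective on a window whose image is an edge. Hence the degree
condition applies to the ℓ positions shared with a neighbouring window, before the whole filling is
known to be injective. -/
theorem card_image_of_subset_window {H : KGraph V k} {d r ℓ : ℕ} {z : ℕ → V}
    (hr : (window k d r).image z ∈ H.edges) {K : Finset ℕ} (hK : K ⊆ window k d r)
    (hKc : K.card = ℓ) : (K.image z).card = ℓ ∧ K.image z ⊆ H.verts := by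
  have hinj : Set.InjOn z (window k d r) := by
    rw [← Finset.card_image_iff, H.edge_card _ hr, card_window]
  exact ⟨by rw [Finset.card_image_of_injOn (hinj.mono (Finset.coe_subset.2 hK)), hKc],
    (Finset.image_subset_image hK).trans (H.edge_subset _ hr)⟩

variable {H : KGraph V k} {d ℓ L : ℕ} {S T : ℕ → V} {X : Finset V} {v₀ : V} {D Q : Finset ℕ}
  {a : ℝ}

theorem image_glue_congr {B K : Finset ℕ} (hKB : Disjoint K B) {f h : ℕ → V}
    (hf : ∀ j ∉ B, h j = f j) : K.image (glue ℓ L S T h) = K.image (glue ℓ L S T f) := by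
  refine Finset.image_congr fun j hj => ?_
  simp only [glue, hf j (Finset.disjoint_left.1 hKB hj)]

/-- K holds the ℓ positions of window r that are already filled and B the new ones, so there are at
least β completions. The windows in Q do not meet B and keep their images. -/
theorem HasManyConnections.insert_edge (h : HasManyConnections H d ℓ L S T X v₀ D Q a)
    {β : ℝ} (hβ : ∀ S ⊆ H.verts, S.card = ℓ → β ≤ H.deg S X) (hβ0 : 0 ≤ β)
    {B K : Finset ℕ} {r : ℕ} (hr : window k d r = K ∪ B) (hKB : Disjoint K B)
    (hDB : Disjoint D B) (hB : ∀ j ∈ B, ℓ ≤ j ∧ j < L) (hBc : ℓ + B.card = k)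
    (hQ : ∀ r' ∈ Q, Disjoint (window k d r') B)
    (hK : ∀ f : ℕ → V, (∀ r ∈ Q, (window k d r).image (glue ℓ L S T f) ∈ H.edges) →
      (K.image (glue ℓ L S T f)).card = ℓ ∧ K.image (glue ℓ L S T f) ⊆ H.verts) :
    HasManyConnections H d ℓ L S T X v₀ (D ∪ B) (insert r Q) (β * a) := by
  classical
  obtain ⟨A, hA, hAc, hAe⟩ := h
  have hex : ∀ f : ℕ → V, ∃ E : Finset (ℕ → V), f ∈ A → E ⊆ mapsInto B X v₀ ∧ β ≤ E.card ∧
      ∀ ψ ∈ E, K.image (glue ℓ L S T f) ∪ B.image ψ ∈ H.edges := by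
    intro f
    by_cases hf : f ∈ A
    · obtain ⟨h1, h2⟩ := hK f (hAe f hf)
      obtain ⟨E, hE, hEc, hEe⟩ := H.exists_edge_extensions (S := K.image (glue ℓ L S T f)) (X := X)
        (B := B) (by rw [h1, hBc]) v₀
      exact ⟨E, fun _ => ⟨hE, (hβ _ h2 h1).trans (by exact_mod_cast hEc), hEe⟩⟩
    · exact ⟨∅, fun h => absurd h hf⟩
  choose E hE using hex
  obtain ⟨A', hA', hc, hA'e⟩ := exists_extension_family hDB hA (fun f hf => (hE f hf).1)
    (fun f hf => (hE f hf).2.1)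
  refine ⟨A', hA', (mul_le_mul_of_nonneg_left hAc hβ0).trans hc, fun h hh r' hr' => ?_⟩
  obtain ⟨f, hf, ψ, hψ, h1, h2⟩ := hA'e h hh
  rcases Finset.mem_insert.1 hr' with rfl | hr'
  · rw [hr, Finset.image_union, image_glue_congr hKB h1]
    have : B.image (glue ℓ L S T h) = B.image ψ := by
      refine Finset.image_congr fun j hj => ?_
      have := hB j hj
      rw [glue, if_neg (by omega), if_pos (by omega), h2 j hj]
    rw [this]
    exact (hE f hf).2.2 ψ hψ
  · rw [image_glue_congr (hQ r' hr') h1]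
    exact hAe f hf r' hr'

theorem HasManyConnections.union_free (h : HasManyConnections H d ℓ L S T X v₀ D Q a)
    {B : Finset ℕ} (hDB : Disjoint D B) (hQ : ∀ r' ∈ Q, Disjoint (window k d r') B) :
    HasManyConnections H d ℓ L S T X v₀ (D ∪ B) Q (X.card ^ B.card * a) := by
  obtain ⟨A, hA, hAc, hAe⟩ := h
  obtain ⟨A', hA', hc, hA'e⟩ := exists_extension_family (κ := (X.card : ℝ) ^ B.card)
    (E := fun _ => mapsInto B X v₀) hDB hA (fun f hf => subset_rfl)
    (fun f hf => by rw [card_mapsInto]; push_cast; exact le_rfl)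
  refine ⟨A', hA', (mul_le_mul_of_nonneg_left hAc (by positivity)).trans hc, fun h hh r hr => ?_⟩
  obtain ⟨f, hf, ψ, hψ, h1, h2⟩ := hA'e h hh
  rw [image_glue_congr (hQ r hr) h1]
  exact hAe f hf r hr

/-- Window s begins with the last ℓ positions of window s - 1, or with S itself when s = 0, so each
new edge costs one use of the degree condition. -/
theorem hasManyConnections_forward (hd : 0 < d) (hk : ℓ + d = k) {t : ℕ} (hL : L = 3 * t * d)
    (htd : ℓ ≤ t * d)
    {β : ℝ} (hβ : ∀ S ⊆ H.verts, S.card = ℓ → β ≤ H.deg S X) (hβ0 : 0 ≤ β)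
    (hS : Set.InjOn S (Finset.range ℓ)) (hSH : (Finset.range ℓ).image S ⊆ H.verts)
    (s : ℕ) (hs : s ≤ t) :
    HasManyConnections H d ℓ L S T X v₀ (Finset.Ico ℓ (s * d + ℓ)) (Finset.range s) (β ^ s) := by
  induction s with
  | zero =>
    refine ⟨mapsInto ∅ X v₀, by simp, by rw [card_mapsInto]; simp, by simp⟩
  | succ s ih =>
    have hsd : (s + 1) * d ≤ t * d := Nat.mul_le_mul_right _ hs
    have hL' : L = 3 * (t * d) := by rw [hL, mul_assoc]
    rw [add_mul, one_mul] at hsd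
    have h := (ih (by omega)).insert_edge hβ hβ0 (r := s)
      (B := Finset.Ico (s * d + ℓ) (s * d + ℓ + d)) (K := Finset.Ico (s * d) (s * d + ℓ))
      (by ext j; simp only [mem_window, Finset.mem_union, Finset.mem_Ico]; omega)
      (by rw [Finset.disjoint_left]; simp only [Finset.mem_Ico]; omega)
      (by rw [Finset.disjoint_left]; simp only [Finset.mem_Ico]; omega)
      (by simp only [Finset.mem_Ico]; omega)
      (by simp; omega)
      (by
        intro r hr
        have : (r + 1) * d ≤ s * d := Nat.mul_le_mul_right _ (Finset.mem_range.1 hr)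
        rw [add_mul, one_mul] at this
        rw [Finset.disjoint_left]; simp only [mem_window, Finset.mem_Ico]; omega)
      (by
        intro f hf
        rcases Nat.eq_zero_or_pos s with rfl | hs0
        · have : (Finset.Ico (0 * d) (0 * d + ℓ)).image (glue ℓ L S T f)
              = (Finset.range ℓ).image S := by
            rw [zero_mul, zero_add, ← Finset.range_eq_Ico]
            refine Finset.image_congr fun j hj => ?_
            rw [glue, if_pos (by simpa using hj)]
          rw [this]
          exact ⟨by rw [Finset.card_image_of_injOn hS, Finset.card_range], hSH⟩
        · obtain ⟨s', rfl⟩ : ∃ s', s = s' + 1 := ⟨s - 1, by omega⟩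
          refine card_image_of_subset_window (hf s' (by simp)) (fun j hj => ?_) (by simp)
          rw [Finset.mem_Ico, add_mul] at hj
          rw [mem_window]
          omega)
    rw [Finset.range_add_one, pow_succ']
    convert h using 1
    ext j
    simp only [Finset.mem_union, Finset.mem_Ico, add_mul]
    omega

/-- The mirror image, completing windows to the left from T at position L. The new positions are at
least 2td, while the first t windows end before td + ℓ ≤ 2td, so both ends are built independently.
-/
theorem hasManyConnections_backward (hd : 0 < d) (hk : ℓ + d = k) {t : ℕ} (hL : L = 3 * t * d)
    (htd : ℓ ≤ t * d)
    {β : ℝ} (hβ : ∀ S ⊆ H.verts, S.card = ℓ → β ≤ H.deg S X) (hβ0 : 0 ≤ β)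
    (hS : Set.InjOn S (Finset.range ℓ)) (hSH : (Finset.range ℓ).image S ⊆ H.verts)
    (hT : Set.InjOn T (Finset.range ℓ)) (hTH : (Finset.range ℓ).image T ⊆ H.verts)
    (s : ℕ) (hs : s ≤ t) :
    HasManyConnections H d ℓ L S T X v₀
      (Finset.Ico ℓ (t * d + ℓ) ∪ Finset.Ico ((3 * t - s) * d) L)
      (Finset.range t ∪ Finset.Ico (3 * t - s) (3 * t)) (β ^ (t + s)) := by
  have hL' : L = 3 * (t * d) := by rw [hL, mul_assoc]
  induction s with
  | zero =>
    have h := hasManyConnections_forward (T := T) (v₀ := v₀) hd hk hL htd hβ hβ0 hS hSH t le_rfl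
    simpa [hL] using h
  | succ s ih =>
    obtain ⟨r, hr⟩ : ∃ r, 3 * t = r + s + 1 := ⟨3 * t - s - 1, by omega⟩
    have e1 : 3 * t - s = r + 1 := by omega
    have e2 : 3 * t - (s + 1) = r := by omega
    have hrt : 2 * t ≤ r := by omega
    have h2 : 2 * t * d ≤ r * d := Nat.mul_le_mul_right _ hrt
    rw [mul_assoc] at h2
    have h3 : (r + 1) * d ≤ 3 * t * d := Nat.mul_le_mul_right _ (by omega)
    rw [mul_assoc, add_mul, one_mul] at h3
    have ih' := ih (by omega)
    rw [e1] at ih'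
    have h := ih'.insert_edge hβ hβ0 (r := r)
      (B := Finset.Ico (r * d) (r * d + d)) (K := Finset.Ico (r * d + d) (r * d + d + ℓ))
      (by ext j; simp only [mem_window, Finset.mem_union, Finset.mem_Ico]; omega)
      (by rw [Finset.disjoint_left]; simp only [Finset.mem_Ico]; omega)
      (by
        rw [Finset.disjoint_left]
        simp only [Finset.mem_Ico, Finset.mem_union, add_mul]; omega)
      (by simp only [Finset.mem_Ico]; omega)
      (by simp; omega)
      (by
        intro r' hr'
        rw [Finset.disjoint_left]
        rcases Finset.mem_union.1 hr' with hr' | hr'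
        · have : (r' + 1) * d ≤ t * d := Nat.mul_le_mul_right _ (Finset.mem_range.1 hr')
          rw [add_mul, one_mul] at this
          simp only [mem_window, Finset.mem_Ico]; omega
        · have : (r + 1) * d ≤ r' * d := Nat.mul_le_mul_right _ (Finset.mem_Ico.1 hr').1
          rw [add_mul, one_mul] at this
          simp only [mem_window, Finset.mem_Ico]; omega)
      (by
        intro f hf
        rcases Nat.eq_zero_or_pos s with rfl | hs0
        · have hrL : r * d + d = L := by rw [hL, hr]; ring
          have : (Finset.Ico (r * d + d) (r * d + d + ℓ)).image (glue ℓ L S T f)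
              = (Finset.range ℓ).image T := by
            have h4 : Finset.Ico (r * d + d) (r * d + d + ℓ) = (Finset.range ℓ).image (L + ·) := by
              rw [hrL, Finset.range_eq_Ico, Finset.image_add_left_Ico, add_zero]
            rw [h4, Finset.image_image]
            refine Finset.image_congr fun j hj => ?_
            simp only [Function.comp_apply]
            rw [glue, if_neg (by omega), if_neg (by omega), Nat.add_sub_cancel_left]
          rw [this]
          exact ⟨by rw [Finset.card_image_of_injOn hT, Finset.card_range], hTH⟩
        · refine card_image_of_subset_window (hf (r + 1) ?_) (fun j hj => ?_) (by simp)
          · simp only [Finset.mem_union, Finset.mem_Ico]; omega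
          rw [Finset.mem_Ico] at hj
          rw [mem_window, add_mul]
          omega)
    rw [e2, ← add_assoc t s 1, pow_succ']
    convert h using 1
    · ext j
      simp only [Finset.mem_union, Finset.mem_Ico, add_mul]
      omega
    · ext j
      simp only [Finset.mem_union, Finset.mem_Ico, Finset.mem_insert, Finset.mem_range]
      omega

/-- The maps which connect `S` to `T`, up to the windows with index in `Finset.Ico t (2 * t)`, have
positive density. -/
theorem exists_connections (hd : 0 < d) (hk : ℓ + d = k) {t : ℕ} (ht : 0 < t)
    (htd : ℓ ≤ t * d) (v₀ : V)
    {α : ℝ} (hα : 0 < α) {n : ℕ} (hn : H.verts.card = n) (hn0 : 0 < n) (hX : X ⊆ H.verts)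
    (hdeg : ∀ S ⊆ H.verts, S.card = ℓ → α * n ^ d ≤ H.deg S X)
    (hS : Set.InjOn S (Finset.range ℓ)) (hSH : (Finset.range ℓ).image S ⊆ H.verts)
    (hT : Set.InjOn T (Finset.range ℓ)) (hTH : (Finset.range ℓ).image T ⊆ H.verts)
    (hnlarge : 2 * (3 * t * d - ℓ : ℕ) ^ 2 ≤ α ^ (2 * t + (t * d - ℓ)) * n) :
    ∃ F ⊆ embeddings (Finset.Ico ℓ (3 * t * d)) H.verts v₀,
      (∀ f ∈ F, ∀ j ∈ Finset.Ico ℓ (3 * t * d), f j ∈ X) ∧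
      (∀ f ∈ F, ∀ r ∈ Finset.range t ∪ Finset.Ico (2 * t) (3 * t),
        (window k d r).image (glue ℓ (3 * t * d) S T f) ∈ H.edges) ∧
      α ^ (2 * t + (t * d - ℓ)) / 2 * n ^ (3 * t * d - ℓ) ≤ F.card := by
  classical
  have h1 := hasManyConnections_backward (v₀ := v₀) hd hk rfl htd hdeg (by positivity)
    hS hSH hT hTH t le_rfl
  have e1 : 3 * t - t = 2 * t := by omega
  rw [e1] at h1
  have e3 : 3 * t * d = 3 * (t * d) := mul_assoc _ _ _
  have e2 : 2 * t * d = 2 * (t * d) := mul_assoc _ _ _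
  -- No window required so far meets these positions, so they take arbitrary values in X.
  obtain ⟨A, hA, hAc, hAe⟩ := h1.union_free (B := Finset.Ico (t * d + ℓ) (2 * t * d))
    (by
      rw [Finset.disjoint_left]
      simp only [Finset.mem_Ico, Finset.mem_union]; omega)
    (by
      intro r' hr'
      rw [Finset.disjoint_left]
      rcases Finset.mem_union.1 hr' with hr' | hr'
      · have : (r' + 1) * d ≤ t * d := Nat.mul_le_mul_right _ (Finset.mem_range.1 hr')
        rw [add_mul, one_mul] at this
        simp only [mem_window, Finset.mem_Ico]; omega
      · have : 2 * t * d ≤ r' * d := Nat.mul_le_mul_right _ (Finset.mem_Ico.1 hr').1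
        simp only [mem_window, Finset.mem_Ico]; omega)
  have hD : Finset.Ico ℓ (t * d + ℓ) ∪ Finset.Ico (2 * t * d) (3 * t * d) ∪
      Finset.Ico (t * d + ℓ) (2 * t * d) = Finset.Ico ℓ (3 * t * d) := by
    ext j
    simp only [Finset.mem_union, Finset.mem_Ico]
    omega
  rw [hD] at hA
  have hn' : (0 : ℝ) < n := by exact_mod_cast hn0
  have hXc : α * n ≤ X.card := by
    have h2 := hdeg _ hSH (by rw [Finset.card_image_of_injOn hS, Finset.card_range])
    have h3 := H.deg_le_card_pow ((Finset.range ℓ).image S) X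
    rw [Finset.card_image_of_injOn hS, Finset.card_range, show k - ℓ = (d - 1) + 1 by omega] at h3
    have h4 : (X.card : ℝ) ^ (d - 1 + 1) ≤ n ^ (d - 1) * X.card := by
      rw [pow_succ]
      have : (X.card : ℝ) ≤ n := by exact_mod_cast hn ▸ Finset.card_le_card hX
      gcongr
    have h5 : α * n ^ d = n ^ (d - 1) * (α * n) := by
      obtain ⟨d', rfl⟩ : ∃ d', d = d' + 1 := ⟨d - 1, by omega⟩
      simp only [Nat.add_sub_cancel]; ring
    have h6 : (n : ℝ) ^ (d - 1) * (α * n) ≤ n ^ (d - 1) * X.card := by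
      rw [← h5]
      refine h2.trans (le_trans ?_ h4)
      exact_mod_cast h3
    exact le_of_mul_le_mul_left h6 (by positivity)
  have hX' : ∀ f ∈ A, ∀ j ∈ Finset.Ico ℓ (3 * t * d), f j ∈ X := fun f hf =>
    (mem_mapsInto.1 (hA hf)).1
  have hAH : ∀ f ∈ A, f ∈ mapsInto (Finset.Ico ℓ (3 * t * d)) H.verts v₀ := fun f hf =>
    mem_mapsInto.2 ⟨fun j hj => hX (hX' f hf j hj), (mem_mapsInto.1 (hA hf)).2⟩
  have hM : (Finset.Ico ℓ (3 * t * d)).card = 3 * t * d - ℓ := Nat.card_Ico _ _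
  refine ⟨A.filter fun f => Set.InjOn f (Finset.Ico ℓ (3 * t * d)), fun f hf => ?_,
    fun f hf => hX' f (Finset.mem_filter.1 hf).1,
    fun f hf => hAe f (Finset.mem_filter.1 hf).1, ?_⟩
  · rw [Finset.mem_filter] at hf
    exact mem_embeddings.2 ⟨hAH f hf.1, hf.2⟩
  -- Non-injective fillings are of lower order in n; by `hnlarge` they are at most half of the
  -- guaranteed number.
  have hbad : (A.filter fun f => ¬ Set.InjOn f (Finset.Ico ℓ (3 * t * d))).card
      ≤ (3 * t * d - ℓ) ^ 2 * n ^ (3 * t * d - ℓ - 1) := by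
    have := card_mapsInto_not_injOn_le (T := H.verts) (v₀ := v₀) (J := Finset.Ico ℓ (3 * t * d))
      (F := A.filter fun f => ¬ Set.InjOn f (Finset.Ico ℓ (3 * t * d))) fun f hf => by
        rw [Finset.mem_filter] at hf
        exact ⟨hAH f hf.1, hf.2⟩
    rwa [hM, hn] at this
  have hsplit := Finset.card_filter_add_card_filter_not (s := A)
    (fun f => Set.InjOn f (Finset.Ico ℓ (3 * t * d)))
  have hsplit' : ((A.filter fun f => Set.InjOn f (Finset.Ico ℓ (3 * t * d))).card : ℝ) +
      (A.filter fun f => ¬ Set.InjOn f (Finset.Ico ℓ (3 * t * d))).card = A.card := by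
    exact_mod_cast hsplit
  have hbad' : ((A.filter fun f => ¬ Set.InjOn f (Finset.Ico ℓ (3 * t * d))).card : ℝ)
      ≤ (3 * t * d - ℓ : ℕ) ^ 2 * n ^ (3 * t * d - ℓ - 1) := by exact_mod_cast hbad
  have htd0 : 0 < t * d := Nat.mul_pos ht hd
  -- The 2t edges give a factor αn^d each and the td - ℓ free positions a factor αn each.
  have hAlow : α ^ (2 * t + (t * d - ℓ)) * n ^ (3 * t * d - ℓ) ≤ A.card := by
    refine le_trans ?_ hAc
    rw [Nat.card_Ico, show 2 * t * d - (t * d + ℓ) = t * d - ℓ by omega]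
    calc α ^ (2 * t + (t * d - ℓ)) * (n : ℝ) ^ (3 * t * d - ℓ)
        = (α * n) ^ (t * d - ℓ) * (α * n ^ d) ^ (t + t) := by
          rw [show 3 * t * d - ℓ = (t * d - ℓ) + d * (t + t) by
            rw [e3, mul_add, mul_comm d t]; omega]
          rw [mul_pow, mul_pow, pow_add, pow_add, ← pow_mul, two_mul]; ring
      _ ≤ _ := by gcongr
  have hpow : (n : ℝ) ^ (3 * t * d - ℓ) = n * n ^ (3 * t * d - ℓ - 1) := by
    rw [← pow_succ']; congr 1; omega
  have h7 : ((3 * t * d - ℓ : ℕ) : ℝ) ^ 2 * n ^ (3 * t * d - ℓ - 1)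
      ≤ α ^ (2 * t + (t * d - ℓ)) / 2 * n ^ (3 * t * d - ℓ) := by
    rw [hpow, ← mul_assoc]
    refine mul_le_mul_of_nonneg_right ?_ (by positivity)
    linarith
  linarith

end Extension

/-! ### Joining paths greedily into one cyclic sequence. -/

section Joining

variable {V : Type*} {k d ℓ L : ℕ}

/-- The first `m * d + ℓ` values of `v`, followed by `f ℓ, …, f (L - 1)` and then `w`. -/
def join (d ℓ L m : ℕ) (v w f : ℕ → V) : ℕ → V :=
  glue (m * d + ℓ) (m * d + L) v w fun j => f (j - m * d)

theorem join_of_lt {m : ℕ} (v w f : ℕ → V) {j : ℕ} (hj : j < m * d + ℓ) :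
    join d ℓ L m v w f j = v j := by
  rw [join, glue, if_pos hj]

theorem join_add {m : ℕ} (v w f : ℕ → V) (x : ℕ) :
    join d ℓ L m v w f (m * d + x) = glue ℓ L (fun j => v (m * d + j)) w f x := by
  simp only [join, glue, add_lt_add_iff_left, Nat.add_sub_add_left, Nat.add_sub_cancel_left]

theorem join_add_add {m : ℕ} (hL : ℓ ≤ L) (v w f : ℕ → V) (x : ℕ) :
    join d ℓ L m v w f (m * d + (L + x)) = w x := by
  rw [join_add, glue, if_neg (by omega), if_neg (by omega), Nat.add_sub_cancel_left]

theorem join_cases {m : ℕ} (v w f : ℕ → V) (j : ℕ) :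
    (j < m * d + ℓ ∧ join d ℓ L m v w f j = v j) ∨
    (∃ x ∈ Finset.Ico ℓ L, j = m * d + x ∧ join d ℓ L m v w f j = f x) ∨
    (∃ x, m * d + ℓ ≤ j ∧ m * d + L ≤ j ∧ j = m * d + L + x ∧ join d ℓ L m v w f j = w x) := by
  unfold join glue
  split_ifs with h1 h2
  · exact Or.inl ⟨h1, rfl⟩
  · refine Or.inr (Or.inl ⟨j - m * d, ?_, ?_, rfl⟩)
    · rw [Finset.mem_Ico]; omega
    · omega
  · exact Or.inr (Or.inr ⟨j - (m * d + L), by omega, by omega, by omega, rfl⟩)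

/-- Joining injective sequences with pairwise disjoint values gives an injective sequence. -/
theorem injOn_join {m b : ℕ} {v w f : ℕ → V} (hv : Set.InjOn v (Finset.range (m * d + ℓ)))
    (hw : Set.InjOn w (Finset.range b)) (hf : Set.InjOn f (Finset.Ico ℓ L))
    (hvf : ∀ i < m * d + ℓ, ∀ j ∈ Finset.Ico ℓ L, v i ≠ f j)
    (hvw : ∀ i < m * d + ℓ, ∀ j < b, v i ≠ w j)
    (hfw : ∀ i ∈ Finset.Ico ℓ L, ∀ j < b, f i ≠ w j) :
    Set.InjOn (join d ℓ L m v w f) (Finset.range (m * d + L + b)) := by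
  intro i hi j hj h
  rw [Finset.mem_coe, Finset.mem_range] at hi hj
  rcases join_cases (d := d) (ℓ := ℓ) (L := L) (m := m) v w f i with
    ⟨hi1, hi2⟩ | ⟨x, hx, rfl, hi2⟩ | ⟨x, -, -, rfl, hi2⟩ <;>
  rcases join_cases (d := d) (ℓ := ℓ) (L := L) (m := m) v w f j with
    ⟨hj1, hj2⟩ | ⟨y, hy, rfl, hj2⟩ | ⟨y, -, -, rfl, hj2⟩ <;>
  rw [hi2, hj2] at h
  · exact hv (by simpa using hi1) (by simpa using hj1) h
  · exact absurd h (hvf i hi1 y hy)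
  · exact absurd h (hvw i hi1 y (by omega))
  · exact absurd h.symm (hvf j hj1 x hx)
  · rw [hf hx hy h]
  · exact absurd h (hfw x hx y (by omega))
  · exact absurd h.symm (hvw j hj1 x (by omega))
  · exact absurd h.symm (hfw y hy x (by omega))
  · rw [hw (by simp; omega) (by simp; omega) h]

variable [DecidableEq V]

theorem image_window_add (m r : ℕ) (u : ℕ → V) :
    (window k d (m + r)).image u = (window k d r).image fun x => u (m * d + x) := by
  have : window k d (m + r) = (window k d r).image (m * d + ·) := by
    rw [window, window, Finset.image_add_left_Ico, add_mul, add_assoc]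
  rw [this, Finset.image_image]
  rfl

/-- Joining paths via a connection gives a path. -/
theorem image_window_join_mem {t m b : ℕ} {v w f : ℕ → V} {E : Finset (Finset V)}
    (hk : ℓ + d = k) (hL : L = 3 * t * d) (hℓL : ℓ ≤ L)
    (hv : ∀ r < m, (window k d r).image v ∈ E) (hw : ∀ r < b, (window k d r).image w ∈ E)
    (hf : ∀ r < 3 * t, (window k d r).image (glue ℓ L (fun j => v (m * d + j)) w f) ∈ E) :
    ∀ r < m + 3 * t + b, (window k d r).image (join d ℓ L m v w f) ∈ E := by
  intro r hr
  -- Windows before m lie inside v, the next 3t are those of the connection, and the remaining ones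
  -- are shifted windows of w.
  by_cases h1 : r < m
  · have : (window k d r).image (join d ℓ L m v w f) = (window k d r).image v := by
      refine Finset.image_congr fun j hj => join_of_lt v w f ?_
      have h2 := (mem_window.1 hj).2
      have : (r + 1) * d ≤ m * d := Nat.mul_le_mul_right _ h1
      rw [add_mul, one_mul] at this
      omega
    rw [this]
    exact hv r h1
  obtain ⟨r, rfl⟩ : ∃ r', r = m + r' := ⟨r - m, by omega⟩
  by_cases h2 : r < 3 * t
  · rw [image_window_add]
    simp_rw [join_add]
    exact hf r h2
  obtain ⟨r, rfl⟩ : ∃ r', r = 3 * t + r' := ⟨r - 3 * t, by omega⟩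
  rw [image_window_add, image_window_add, ← hL]
  simp_rw [join_add_add hℓL]
  exact hw r (by omega)

theorem card_image_Ico_le (f : ℕ → V) (M : ℕ) (hM : L - ℓ = M) :
    ((Finset.Ico ℓ L).image f).card ≤ M :=
  Finset.card_image_le.trans (by rw [Nat.card_Ico, hM])

variable {E : Finset (Finset V)} {X : Finset V} {q t M : ℕ} {m : ℕ → ℕ} {w : ℕ → ℕ → V}

/-- Joining the paths `w 0, …, w i` to one path. -/
theorem exists_joined_path (hk : ℓ + d = k) (hL : L = 3 * t * d)
    (hℓL : ℓ ≤ L) (hM : L - ℓ = M)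
    (hw : ∀ i < q, Set.InjOn (w i) (Finset.range (m i * d + ℓ)))
    (hwE : ∀ i < q, ∀ r < m i, (window k d r).image (w i) ∈ E)
    (hdisj : ∀ i < q, ∀ i' < q, i ≠ i' → ∀ j < m i * d + ℓ, ∀ j' < m i' * d + ℓ, w i j ≠ w i' j')
    (hwX : ∀ i < q, ∀ j < m i * d + ℓ, w i j ∉ X)
    (hconn : ∀ i < q, ∀ W ⊆ X, W.card ≤ q * M → ∃ f : ℕ → V,
      (∀ j ∈ Finset.Ico ℓ L, f j ∈ X ∧ f j ∉ W) ∧ Set.InjOn f (Finset.Ico ℓ L) ∧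
      ∀ r < 3 * t, (window k d r).image
        (glue ℓ L (fun j => w i (m i * d + j)) (w ((i + 1) % q)) f) ∈ E)
    (i : ℕ) (hi : i < q) :
    ∃ (b : ℕ) (v : ℕ → V), Set.InjOn v (Finset.range (b * d + ℓ)) ∧
      (∀ r < b, (window k d r).image v ∈ E) ∧
      (∀ j < ℓ, v j = w 0 j) ∧ (∀ j < ℓ, v (b * d + j) = w i (m i * d + j)) ∧
      (∀ j < b * d + ℓ, v j ∈ X ∨ ∃ a ≤ i, ∃ j' < m a * d + ℓ, v j = w a j') ∧
      ((Finset.range (b * d + ℓ)).image v ∩ X).card ≤ i * M ∧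
      ∀ a ≤ i, ∃ s, s + m a ≤ b ∧ ∀ j < m a * d + ℓ, v (s * d + j) = w a j := by
  induction i with
  | zero =>
    refine ⟨m 0, w 0, hw 0 hi, hwE 0 hi, fun _ _ => rfl, fun _ _ => rfl,
      fun j hj => Or.inr ⟨0, le_rfl, j, hj, rfl⟩, ?_, fun a ha => ?_⟩
    · rw [zero_mul, Nat.le_zero, Finset.card_eq_zero, ← Finset.disjoint_iff_inter_eq_empty,
        Finset.disjoint_left]
      intro x hx
      obtain ⟨j, hj, rfl⟩ := Finset.mem_image.1 hx
      exact hwX 0 hi j (Finset.mem_range.1 hj)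
    · obtain rfl : a = 0 := by omega
      exact ⟨0, by omega, fun j _ => by rw [zero_mul, zero_add]⟩
  | succ i ih =>
    obtain ⟨b, v, hv, hvE, hv0, hvl, hvm, hvX, hvP⟩ := ih (by omega)
    -- W is the part of X used so far. Each connection adds at most M vertices to it, so the bound q
    -- * M holds at every stage.
    set W := (Finset.range (b * d + ℓ)).image v ∩ X with hW
    obtain ⟨f, hfX, hf, hfE⟩ := hconn i (by omega) W Finset.inter_subset_right
      (hvX.trans (Nat.mul_le_mul_right _ (by omega)))
    rw [Nat.mod_eq_of_lt hi] at hfE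
    have hb : (b + 3 * t + m (i + 1)) * d + ℓ = b * d + L + (m (i + 1) * d + ℓ) := by
      rw [hL]; ring
    have hvw : ∀ x < b * d + ℓ, ∀ j < m (i + 1) * d + ℓ, v x ≠ w (i + 1) j := by
      intro x hx j hj h
      rcases hvm x hx with h1 | ⟨a, ha, j', hj', h1⟩
      · exact hwX (i + 1) hi j hj (h ▸ h1)
      · exact hdisj a (by omega) (i + 1) hi (by omega) j' hj' j hj (h1 ▸ h)
    refine ⟨b + 3 * t + m (i + 1), join d ℓ L b v (w (i + 1)) f, ?_, ?_, ?_, ?_, ?_, ?_, ?_⟩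
    · rw [hb]
      refine injOn_join hv (hw _ hi) hf (fun x hx j hj h => ?_) hvw (fun x hx j hj h => ?_)
      · refine (hfX j hj).2 (Finset.mem_inter.2 ⟨?_, (hfX j hj).1⟩)
        exact h ▸ Finset.mem_image_of_mem v (Finset.mem_range.2 hx)
      · exact hwX (i + 1) hi j hj (h ▸ (hfX x hx).1)
    · refine image_window_join_mem hk hL hℓL hvE (hwE _ hi) fun r hr => ?_
      convert hfE r hr using 1
      refine Finset.image_congr fun x _ => ?_
      unfold glue
      split_ifs with h
      · exact hvl x h
      all_goals rfl
    · intro j hj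
      rw [join_of_lt _ _ _ (by omega), hv0 j hj]
    · intro j hj
      rw [show (b + 3 * t + m (i + 1)) * d + j = b * d + (L + (m (i + 1) * d + j)) by rw [hL]; ring,
        join_add_add hℓL]
    · intro j hj
      rcases join_cases (d := d) (ℓ := ℓ) (L := L) (m := b) v (w (i + 1)) f j with
        ⟨h1, h2⟩ | ⟨x, hx, rfl, h2⟩ | ⟨x, -, -, rfl, h2⟩ <;> rw [h2]
      · rcases hvm j h1 with h3 | ⟨a, ha, h3⟩
        · exact Or.inl h3
        · exact Or.inr ⟨a, by omega, h3⟩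
      · exact Or.inl (hfX x hx).1
      · exact Or.inr ⟨i + 1, le_rfl, x, by omega, rfl⟩
    · have hsub : (Finset.range ((b + 3 * t + m (i + 1)) * d + ℓ)).image
          (join d ℓ L b v (w (i + 1)) f) ∩ X ⊆ W ∪ (Finset.Ico ℓ L).image f := by
        intro y hy
        obtain ⟨hy, hyX⟩ := Finset.mem_inter.1 hy
        obtain ⟨j, hj, rfl⟩ := Finset.mem_image.1 hy
        rw [Finset.mem_range] at hj
        rcases join_cases (d := d) (ℓ := ℓ) (L := L) (m := b) v (w (i + 1)) f j with
          ⟨h1, h2⟩ | ⟨x, hx, rfl, h2⟩ | ⟨x, -, -, rfl, h2⟩ <;> rw [h2] at hyX ⊢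
        · exact Finset.mem_union_left _ (Finset.mem_inter.2
            ⟨Finset.mem_image_of_mem v (Finset.mem_range.2 h1), hyX⟩)
        · exact Finset.mem_union_right _ (Finset.mem_image_of_mem f hx)
        · exact absurd hyX (hwX (i + 1) hi x (by omega))
      refine (Finset.card_le_card hsub).trans ((Finset.card_union_le _ _).trans ?_)
      rw [add_mul, one_mul]
      exact add_le_add hvX (card_image_Ico_le f M hM)
    · intro a ha
      rcases Nat.lt_or_ge i a with h | h
      · obtain rfl : a = i + 1 := by omega
        refine ⟨b + 3 * t, by omega, fun j _ => ?_⟩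
        rw [show (b + 3 * t) * d + j = b * d + (L + j) by rw [hL]; ring, join_add_add hℓL]
      · obtain ⟨s, hs, hsv⟩ := hvP a h
        refine ⟨s, by omega, fun j hj => ?_⟩
        rw [join_of_lt _ _ _ ?_, hsv j hj]
        have : (s + m a) * d ≤ b * d := Nat.mul_le_mul_right _ hs
        rw [add_mul] at this
        omega

/-- Joining the paths `w 0, …, w (q - 1)` to a cycle. -/
theorem exists_joined_cycle (hq : 0 < q) (hk : ℓ + d = k) (hL : L = 3 * t * d)
    (hℓL : ℓ ≤ L) (hM : L - ℓ = M)
    (hw : ∀ i < q, Set.InjOn (w i) (Finset.range (m i * d + ℓ)))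
    (hwE : ∀ i < q, ∀ r < m i, (window k d r).image (w i) ∈ E)
    (hdisj : ∀ i < q, ∀ i' < q, i ≠ i' → ∀ j < m i * d + ℓ, ∀ j' < m i' * d + ℓ, w i j ≠ w i' j')
    (hwX : ∀ i < q, ∀ j < m i * d + ℓ, w i j ∉ X)
    (hconn : ∀ i < q, ∀ W ⊆ X, W.card ≤ q * M → ∃ f : ℕ → V,
      (∀ j ∈ Finset.Ico ℓ L, f j ∈ X ∧ f j ∉ W) ∧ Set.InjOn f (Finset.Ico ℓ L) ∧
      ∀ r < 3 * t, (window k d r).image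
        (glue ℓ L (fun j => w i (m i * d + j)) (w ((i + 1) % q)) f) ∈ E) :
    ∃ (b : ℕ) (v : ℕ → V), 3 * t ≤ b ∧ Set.InjOn v (Finset.range (b * d)) ∧
      (∀ r < b, (window k d r).image (fun x => v (x % (b * d))) ∈ E) ∧
      (∀ j < b * d, v j ∈ X ∨ ∃ a < q, ∃ j' < m a * d + ℓ, v j = w a j') ∧
      ((Finset.range (b * d)).image v ∩ X).card ≤ q * M ∧
      ∀ a < q, ∃ s, s + m a ≤ b ∧ (∀ j < m a * d + ℓ, s * d + j < b * d) ∧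
        ∀ j < m a * d + ℓ, v (s * d + j) = w a j := by
  obtain ⟨i, rfl⟩ : ∃ i, q = i + 1 := ⟨q - 1, by omega⟩
  obtain ⟨b, v, hv, hvE, hv0, hvl, hvm, hvX, hvP⟩ :=
    exists_joined_path hk hL hℓL hM hw hwE hdisj hwX hconn i (by omega)
  set W := (Finset.range (b * d + ℓ)).image v ∩ X with hW
  obtain ⟨f, hfX, hf, hfE⟩ := hconn i (by omega) W Finset.inter_subset_right
    (hvX.trans (Nat.mul_le_mul_right _ (by omega)))
  rw [Nat.mod_self] at hfE
  have hb : (b + 3 * t) * d = b * d + L := by rw [hL]; ring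
  -- The path is joined to itself. Only the first ℓ entries of the second copy are needed, and
  -- reduction modulo b * d + L identifies them with the start.
  set u := join d ℓ L b v v f with hu
  have hmod : ∀ x < b * d + L + ℓ, u (x % (b * d + L)) = u x := by
    intro x hx
    rcases Nat.lt_or_ge x (b * d + L) with h | h
    · rw [Nat.mod_eq_of_lt h]
    · obtain ⟨y, rfl⟩ : ∃ y, x = b * d + L + y := ⟨x - (b * d + L), by omega⟩
      rw [Nat.add_mod_left, Nat.mod_eq_of_lt (by omega), hu, join_of_lt _ _ _ (by omega),
        add_assoc, join_add_add hℓL]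
  have huE := image_window_join_mem (b := 0) (w := v) (f := f) hk hL hℓL hvE
    (fun r hr => absurd hr (by omega)) (fun r hr => by
      convert hfE r hr using 1
      refine Finset.image_congr fun x hx => ?_
      have hx2 := (mem_window.1 hx).2
      have : (r + 1) * d ≤ 3 * t * d := Nat.mul_le_mul_right _ hr
      rw [add_mul, one_mul] at this
      unfold glue
      split_ifs with h h'
      · exact hvl x h
      · rfl
      · exact hv0 _ (by omega))
  refine ⟨b + 3 * t, u, by omega, ?_, ?_, ?_, ?_, ?_⟩
  · rw [hb]
    have := injOn_join (b := 0) (w := v) hv (by simp) hf (fun x hx j hj h => ?_)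
      (fun x hx j hj => absurd hj (by omega)) (fun x hx j hj => absurd hj (by omega))
    · simpa using this
    · refine (hfX j hj).2 (Finset.mem_inter.2 ⟨?_, (hfX j hj).1⟩)
      exact h ▸ Finset.mem_image_of_mem v (Finset.mem_range.2 hx)
  · intro r hr
    convert huE r (by omega) using 1
    refine Finset.image_congr fun x hx => ?_
    have hx2 := (mem_window.1 hx).2
    have : (r + 1) * d ≤ (b + 3 * t) * d := Nat.mul_le_mul_right _ hr
    rw [add_mul, one_mul] at this
    simp only [hb] at this ⊢
    exact hmod x (by omega)
  · intro j hj
    rcases join_cases (d := d) (ℓ := ℓ) (L := L) (m := b) v v f j with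
      ⟨h1, h2⟩ | ⟨x, hx, rfl, h2⟩ | ⟨x, -, h3, -, h2⟩
    · rw [hu, h2]
      rcases hvm j h1 with h3 | ⟨a, ha, h3⟩
      · exact Or.inl h3
      · exact Or.inr ⟨a, by omega, h3⟩
    · rw [hu, h2]
      exact Or.inl (hfX x hx).1
    · omega
  · have hsub : (Finset.range ((b + 3 * t) * d)).image u ∩ X ⊆ W ∪ (Finset.Ico ℓ L).image f := by
      intro y hy
      obtain ⟨hy, hyX⟩ := Finset.mem_inter.1 hy
      obtain ⟨j, hj, rfl⟩ := Finset.mem_image.1 hy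
      rw [Finset.mem_range] at hj
      rcases join_cases (d := d) (ℓ := ℓ) (L := L) (m := b) v v f j with
        ⟨h1, h2⟩ | ⟨x, hx, rfl, h2⟩ | ⟨x, -, h3, -, h2⟩
      · rw [hu, h2] at hyX ⊢
        exact Finset.mem_union_left _ (Finset.mem_inter.2
          ⟨Finset.mem_image_of_mem v (Finset.mem_range.2 h1), hyX⟩)
      · rw [hu, h2] at hyX ⊢
        exact Finset.mem_union_right _ (Finset.mem_image_of_mem f hx)
      · omega
    refine (Finset.card_le_card hsub).trans ((Finset.card_union_le _ _).trans ?_)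
    rw [add_mul, one_mul]
    exact add_le_add hvX (card_image_Ico_le f M hM)
  · intro a ha
    obtain ⟨s, hs, hsv⟩ := hvP a (by omega)
    have : (s + m a) * d ≤ b * d := Nat.mul_le_mul_right _ hs
    rw [add_mul] at this
    refine ⟨s, by omega, fun j hj => ?_, fun j hj => ?_⟩
    · rw [hb]; omega
    · rw [hu, join_of_lt _ _ _ (by omega), hsv j hj]

end Joining

/-! ### From cyclic sequences to ℓ-cycles. -/

section Cycle

variable {V : Type*} [DecidableEq V] {k ℓ : ℕ}

theorem image_range_eq_image_window (d r : ℕ) (v : ℕ → V) :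
    ((Finset.range k).image fun j => v (r * d + j)) = (window k d r).image v := by
  have : window k d r = (Finset.range k).image (r * d + ·) := by
    rw [window, Finset.range_eq_Ico, Finset.image_add_left_Ico, add_zero]
  rw [this, Finset.image_image]
  rfl

theorem KGraph.IsPathSeq.edges_eq {P : KGraph V k} {m : ℕ} {v : ℕ → V} (h : P.IsPathSeq ℓ m v) :
    P.edges = (Finset.range m).image fun r => (window k (k - ℓ) r).image v := by
  rw [h.2.2]
  simp_rw [image_range_eq_image_window]

theorem cycleEdge_eq (m : ℕ) (v : ℕ → V) (r : ℕ) :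
    KGraph.cycleEdge k ℓ m v r
      = (window k (k - ℓ) r).image fun x => v (x % (m * (k - ℓ))) :=
  image_range_eq_image_window (k - ℓ) r fun x => v (x % (m * (k - ℓ)))

theorem injOn_mod_Ico {V : Type*} {N a : ℕ} {v : ℕ → V} (hv : Set.InjOn v (Finset.range N)) :
    Set.InjOn (fun x => v (x % N)) (Finset.Ico a (a + N)) := by
  intro x hx y hy h
  rw [Finset.mem_coe, Finset.mem_Ico] at hx hy
  have hN : 0 < N := by omega
  have h1 : x % N = y % N := hv (by simpa using Nat.mod_lt x hN) (by simpa using Nat.mod_lt y hN) h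
  have h2 : (N : ℤ) ∣ (y : ℤ) - x := (Nat.modEq_iff_dvd).1 h1
  have h3 : (y : ℤ) - x = 0 := by
    refine Int.eq_zero_of_abs_lt_dvd h2 ?_
    rw [abs_lt]
    omega
  omega

/-- A cyclic sequence all of whose windows are edges of `G` spans an `ℓ`-cycle in `G`. -/
theorem KGraph.exists_cycle_of_seq {G : KGraph V k} (hℓ : ℓ < k) {b : ℕ} {v : ℕ → V} (hb : 1 ≤ b)
    (hbk : k + (k - ℓ) ≤ b * (k - ℓ)) (hv : Set.InjOn v (Finset.range (b * (k - ℓ))))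
    (hvG : ∀ j < b * (k - ℓ), v j ∈ G.verts)
    (hE : ∀ r < b, (window k (k - ℓ) r).image (fun x => v (x % (b * (k - ℓ)))) ∈ G.edges) :
    ∃ C : KGraph V k, C.IsCycle ℓ ∧ C.IsSubgraph G ∧
      C.verts = (Finset.range (b * (k - ℓ))).image v ∧
      C.edges = (Finset.range b).image (KGraph.cycleEdge k ℓ b v) := by
  have hN : 0 < b * (k - ℓ) := by omega
  have hE' : ∀ e ∈ (Finset.range b).image (KGraph.cycleEdge k ℓ b v), e ∈ G.edges := by
    intro e he
    obtain ⟨r, hr, rfl⟩ := Finset.mem_image.1 he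
    rw [cycleEdge_eq]
    exact hE r (Finset.mem_range.1 hr)
  refine ⟨⟨(Finset.range (b * (k - ℓ))).image v,
    (Finset.range b).image (KGraph.cycleEdge k ℓ b v), fun e he => ?_,
    fun e he => G.edge_card e (hE' e he)⟩, ⟨b, v, hb, hv, rfl, rfl, fun r _ => ?_⟩, ⟨?_, hE'⟩,
    rfl, rfl⟩
  · obtain ⟨r, -, rfl⟩ := Finset.mem_image.1 he
    rw [cycleEdge_eq]
    intro y hy
    obtain ⟨x, -, rfl⟩ := Finset.mem_image.1 hy
    exact Finset.mem_image_of_mem v (Finset.mem_range.2 (Nat.mod_lt _ hN))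
  -- Two consecutive windows together span k + (k - ℓ) positions, by `hbk` at most one full turn. So
  -- reduction modulo the length is injective on them, and the edges meet exactly where the windows
  -- do.
  · rw [cycleEdge_eq, cycleEdge_eq, ← Finset.image_inter_of_injOn]
    · have h1 : window k (k - ℓ) r ∩ window k (k - ℓ) (r + 1)
          = Finset.Ico (r * (k - ℓ) + (k - ℓ)) (r * (k - ℓ) + k) := by
        ext j
        simp only [Finset.mem_inter, mem_window, Finset.mem_Ico, add_mul, one_mul]
        omega
      rw [h1, Finset.card_image_of_injOn, Nat.card_Ico]
      · omega
      · refine (injOn_mod_Ico (a := r * (k - ℓ)) hv).mono fun j hj => ?_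
        rw [Finset.mem_coe, Finset.mem_Ico] at hj ⊢
        omega
    · refine (injOn_mod_Ico (a := r * (k - ℓ)) hv).mono fun j hj => ?_
      simp only [Set.mem_union, Finset.mem_coe, mem_window, add_mul, one_mul,
        Finset.mem_Ico] at hj ⊢
      omega
  · intro y hy
    obtain ⟨j, hj, rfl⟩ := Finset.mem_image.1 hy
    exact hvG j (Finset.mem_range.1 hj)

/-- Vertex-disjoint paths which can be connected greedily lie on a common cycle. -/
theorem KGraph.exists_cycle_of_connections {G : KGraph V k} {X : Finset V} {q t : ℕ} (hq : 0 < q)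
    (hℓ : ℓ < k) (ht : 0 < t) (htd : ℓ ≤ t * (k - ℓ)) {P : ℕ → KGraph V k} {m : ℕ → ℕ}
    {w : ℕ → ℕ → V} (hP : ∀ i < q, (P i).IsPathSeq ℓ (m i) (w i))
    (hPG : ∀ i < q, (P i).IsSubgraph G) (hXG : X ⊆ G.verts)
    (hdisj : ∀ i < q, ∀ i' < q, i ≠ i' → Disjoint (P i).verts (P i').verts)
    (hPX : ∀ i < q, Disjoint (P i).verts X)
    (hconn : ∀ i < q, ∀ W ⊆ X, W.card ≤ q * (3 * t * (k - ℓ) - ℓ) → ∃ f : ℕ → V,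
      (∀ j ∈ Finset.Ico ℓ (3 * t * (k - ℓ)), f j ∈ X ∧ f j ∉ W) ∧
      Set.InjOn f (Finset.Ico ℓ (3 * t * (k - ℓ))) ∧
      ∀ r < 3 * t, (window k (k - ℓ) r).image (glue ℓ (3 * t * (k - ℓ))
        (fun j => w i (m i * (k - ℓ) + j)) (w ((i + 1) % q)) f) ∈ G.edges) :
    ∃ C : KGraph V k, C.IsCycle ℓ ∧ C.IsSubgraph G ∧
      (C.verts ∩ X).card ≤ q * (3 * t * (k - ℓ) - ℓ) ∧ ∀ i < q, (P i).IsSubgraph C := by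
  have hmem : ∀ i < q, ∀ j < m i * (k - ℓ) + ℓ, w i j ∈ (P i).verts := fun i hi j hj => by
    rw [(hP i hi).2.1]
    exact Finset.mem_image_of_mem _ (Finset.mem_range.2 hj)
  have e3 : 3 * t * (k - ℓ) = 3 * (t * (k - ℓ)) := mul_assoc _ _ _
  have htd' : 1 * (k - ℓ) ≤ t * (k - ℓ) := Nat.mul_le_mul_right _ ht
  obtain ⟨b, v, hb, hv, hvE, hvm, hvX, hvP⟩ := exists_joined_cycle (E := G.edges) (X := X)
    (d := k - ℓ) (ℓ := ℓ) (k := k) (t := t) (m := m) (w := w) hq (by omega) rfl (by omega) rfl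
    (fun i hi => (hP i hi).1)
    (fun i hi r hr => (hPG i hi).2 (by
      rw [(hP i hi).edges_eq]
      exact Finset.mem_image_of_mem _ (Finset.mem_range.2 hr)))
    (fun i hi i' hi' hne j hj j' hj' h =>
      Finset.disjoint_left.1 (hdisj i hi i' hi' hne) (hmem i hi j hj) (h ▸ hmem i' hi' j' hj'))
    (fun i hi j hj => Finset.disjoint_left.1 (hPX i hi) (hmem i hi j hj)) hconn
  have hbt : 3 * t * (k - ℓ) ≤ b * (k - ℓ) := Nat.mul_le_mul_right _ hb
  -- A single connection already makes the cycle long enough: 3t(k - ℓ) ≥ ℓ + 2(k - ℓ).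
  obtain ⟨C, hC, hCG, hCv, hCe⟩ := KGraph.exists_cycle_of_seq (G := G) hℓ (by omega) (by omega) hv
    (fun j hj => by
      rcases hvm j hj with h | ⟨a, ha, j', hj', h⟩
      · exact hXG h
      · exact h ▸ (hPG a ha).1 (hmem a ha j' hj')) hvE
  refine ⟨C, hC, hCG, by rw [hCv]; exact hvX, fun i hi => ?_⟩
  obtain ⟨s, hs, hsb, hsv⟩ := hvP i hi
  refine ⟨fun y hy => ?_, fun e he => ?_⟩
  · rw [(hP i hi).2.1] at hy
    obtain ⟨j, hj, rfl⟩ := Finset.mem_image.1 hy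
    rw [Finset.mem_range] at hj
    rw [hCv, ← hsv j hj]
    exact Finset.mem_image_of_mem v (Finset.mem_range.2 (hsb j hj))
  · rw [(hP i hi).edges_eq] at he
    obtain ⟨r, hr, rfl⟩ := Finset.mem_image.1 he
    rw [Finset.mem_range] at hr
    rw [hCe]
    refine Finset.mem_image.2 ⟨s + r, Finset.mem_range.2 (by omega), ?_⟩
    rw [cycleEdge_eq, image_window_add]
    refine Finset.image_congr fun x hx => ?_
    have hx2 := (mem_window.1 hx).2
    have : (r + 1) * (k - ℓ) ≤ m i * (k - ℓ) := Nat.mul_le_mul_right _ hr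
    rw [add_mul, one_mul] at this
    have hx3 : x < m i * (k - ℓ) + ℓ := by omega
    rw [Nat.mod_eq_of_lt (hsb x hx3), hsv x hx3]

end Cycle

/-! ### Choice of constants and the main proof. -/

section Main

theorem mem_perturb_edges {V : Type*} [DecidableEq V] {k : ℕ} {H : KGraph V k}
    {R : Set (Finset V)} {e : Finset V} (hc : e.card = k) (he : e ⊆ H.verts)
    (hR : e ∈ H.nonEdges → e ∈ R) : e ∈ (H.perturb R).edges := by
  classical
  by_cases h : e ∈ H.edges
  · exact Finset.mem_union_left _ h
  · have h1 : e ∈ H.nonEdges :=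
      Finset.mem_sdiff.2 ⟨Finset.mem_powersetCard.2 ⟨he, hc⟩, h⟩
    exact Finset.mem_union_right _ (Finset.mem_filter.2 ⟨h1, hR h1⟩)

/-- The number of random edges needed to connect two paths. -/
theorem exists_ceil_sub_one {k ℓ : ℕ} (hℓ : 0 < ℓ) (hℓk : ℓ < k) :
    ∃ t : ℕ, ((⌈(k : ℝ) / ((k : ℝ) - (ℓ : ℝ))⌉ : ℝ) - 1) = t ∧ 0 < t ∧ ℓ ≤ t * (k - ℓ) ∧
      t * (k - ℓ) < k := by
  obtain ⟨d, rfl⟩ : ∃ d, k = ℓ + d := ⟨k - ℓ, by omega⟩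
  have hd : 0 < d := by omega
  have hd' : (0 : ℝ) < d := by exact_mod_cast hd
  have e1 : ((ℓ + d : ℕ) : ℝ) - ℓ = d := by push_cast; ring
  rw [e1, Nat.add_sub_cancel_left]
  set z := ⌈((ℓ + d : ℕ) : ℝ) / d⌉ with hz
  have h1 : ((ℓ + d : ℕ) : ℝ) ≤ z * d := (div_le_iff₀ hd').1 (Int.le_ceil _)
  have h2 : (z : ℝ) * d < (ℓ + d : ℕ) + d := by
    have := Int.ceil_lt_add_one (((ℓ + d : ℕ) : ℝ) / d)
    rw [← hz, div_add_one hd'.ne', lt_div_iff₀ hd'] at this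
    exact this
  have h1' : ((ℓ + d : ℕ) : ℤ) ≤ z * d := by exact_mod_cast h1
  have h2' : z * d < ((ℓ + d : ℕ) : ℤ) + d := by exact_mod_cast h2
  have hz1 : 1 < z := by
    by_contra h
    push_cast at h1'
    nlinarith
  obtain ⟨t, ht⟩ := Int.eq_ofNat_of_zero_le (show 0 ≤ z - 1 by omega)
  have hzt : z = t + 1 := by omega
  rw [hzt] at h1' h2'
  refine ⟨t, by rw [hzt]; push_cast; ring, by omega, ?_, ?_⟩
  · have : (ℓ : ℤ) ≤ t * d := by push_cast at h1'; linarith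
    exact_mod_cast this
  · have : (t * d : ℤ) < ℓ + d := by push_cast at h2'; linarith
    exact_mod_cast this

/-- The failure probability has this form, with n^c in the role of κ; this is where c < 1/t matters.
-/
theorem tendsto_rpow_pow_div {c : ℝ} {t : ℕ} (h : c * t < 1) (A : ℝ) :
    Filter.Tendsto (fun n : ℕ => A * ((n : ℝ) ^ c) ^ t / n) Filter.atTop (nhds 0) := by
  have h1 : Filter.Tendsto (fun n : ℕ => A * (n : ℝ) ^ (-(1 - c * t))) Filter.atTop (nhds 0) := by
    have := ((tendsto_rpow_neg_atTop (sub_pos.2 h)).comp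
      (tendsto_natCast_atTop_atTop (R := ℝ))).const_mul A
    simpa using this
  refine h1.congr' ?_
  filter_upwards [Filter.eventually_gt_atTop 0] with n hn
  have hn' : (0 : ℝ) < n := by exact_mod_cast hn
  rw [← Real.rpow_natCast, ← Real.rpow_mul hn'.le, mul_div_assoc, neg_sub,
    Real.rpow_sub_one hn'.ne']

/-- A list of the paths, with vertex sequences. -/
theorem exists_enumeration {V : Type*} [DecidableEq V] {k ℓ : ℕ} (Ps : Finset (KGraph V k))
    (hne : Ps.Nonempty) (hPs : ∀ P ∈ Ps, P.IsPath ℓ) :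
    ∃ (P : ℕ → KGraph V k) (m : ℕ → ℕ) (w : ℕ → ℕ → V), (∀ i < Ps.card, P i ∈ Ps) ∧
      (∀ i < Ps.card, (P i).IsPathSeq ℓ (m i) (w i)) ∧
      (∀ i < Ps.card, ∀ i' < Ps.card, i ≠ i' → P i ≠ P i') ∧
      ∀ Q ∈ Ps, ∃ i < Ps.card, P i = Q := by
  obtain ⟨P₀, hP₀⟩ := hne
  have hall : ∀ Q : Ps, ∃ (m : ℕ) (v : ℕ → V), Q.1.IsPathSeq ℓ m v := fun Q => hPs Q.1 Q.2
  choose m w hmw using hall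
  let e := Ps.equivFin
  let Q : ℕ → Ps := fun i => if h : i < Ps.card then e.symm ⟨i, h⟩ else ⟨P₀, hP₀⟩
  refine ⟨fun i => (Q i).1, fun i => m (Q i), fun i => w (Q i), fun i _ => (Q i).2,
    fun i _ => hmw (Q i), fun i hi i' hi' hne h => hne ?_, fun R hR => ?_⟩
  · have h1 : Q i = Q i' := Subtype.ext h
    simp only [Q, hi, hi', dif_pos] at h1
    simpa using e.symm.injective h1
  · refine ⟨e ⟨R, hR⟩, (e ⟨R, hR⟩).2, ?_⟩
    simp [Q]

end Main

theorem lemma2p3 (k : ℕ) (α : ℝ) (hα : 0 < α) :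
    ∃ ϑ₀ : ℝ, 0 < ϑ₀ ∧
    ∀ ℓ : ℕ, 2 ≤ ℓ → ℓ < k →
    ∀ c : ℝ, c < 1 / ((⌈(k : ℝ) / ((k : ℝ) - (ℓ : ℝ))⌉ : ℝ) - 1) →
    ∀ ϑ : ℝ, 0 < ϑ → ϑ < ϑ₀ →
    ∀ ε : ℝ, 0 < ε →
    ∃ n₀ : ℕ, ∀ n : ℕ, n₀ ≤ n →
    ∀ (V : Type*) [Fintype V] [DecidableEq V] (H : KGraph V k), H.verts.card = n →
    ∀ Ps : Finset (KGraph V k), Ps.Nonempty →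
      (Ps.card : ℝ) ≤ ϑ * n →
      (∀ P ∈ Ps, P.IsPath ℓ ∧ P.IsSubgraph H) →
      (∀ P ∈ Ps, ∀ Q ∈ Ps, P ≠ Q → Disjoint P.verts Q.verts) →
      (∀ S ⊆ H.verts, S.card = ℓ →
        α * (n : ℝ) ^ (k - ℓ) ≤ (H.deg S (H.uncovered Ps) : ℝ)) →
    ∀ p : I, (n : ℝ) ^ (-((k : ℝ) - (ℓ : ℝ)) - c) ≤ (p : ℝ) →
      1 - ε ≤ (ProbabilityTheory.setBernoulli (H.nonEdges : Set (Finset V)) p).real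
        {R | ∃ C : KGraph V k, C.IsCycle ℓ ∧ C.IsSubgraph (H.perturb R) ∧
          (C.verts ∩ H.uncovered Ps).card ≤ 4 * k * Ps.card ∧
          ∀ P ∈ Ps, P.IsSubgraph C} := by
  -- With β ≤ 1, powers of β decrease in the exponent, so β^(3k) bounds the density δ from below for
  -- every ℓ and `ϑ₀` need not depend on ℓ.
  set β := min α 1 with hβ
  have hβ0 : 0 < β := lt_min hα one_pos
  have hβ1 : β ≤ 1 := min_le_right _ _
  refine ⟨β ^ (3 * k) / (36 * (k + 1) ^ 2), by positivity, ?_⟩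
  intro ℓ hℓ2 hℓk c hc ϑ hϑ0 hϑ ε hε
  obtain ⟨t, htc, ht0, htd, htdk⟩ := exists_ceil_sub_one (by omega) hℓk
  rw [htc] at hc
  have ht0' : (0 : ℝ) < t := by exact_mod_cast ht0
  set d := k - ℓ with hd
  have hd0 : 0 < d := by omega
  have e3 : 3 * t * d = 3 * (t * d) := mul_assoc _ _ _
  have htd' : 1 * d ≤ t * d := Nat.mul_le_mul_right _ ht0
  have htk : t * 1 ≤ t * d := Nat.mul_le_mul_left _ hd0
  set M := 3 * t * d - ℓ with hM
  set J := Finset.Ico ℓ (3 * t * d) with hJ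
  set Q := Finset.Ico t (2 * t) with hQ
  have hJc : J.card = M := Nat.card_Ico _ _
  have hQc : Q.card = t := by rw [hQ, Nat.card_Ico]; omega
  have hM3 : M ≤ 3 * k := by omega
  have hM3' : (M : ℝ) ≤ 3 * k := by exact_mod_cast hM3
  -- The middle windows miss S and T because ℓ ≤ td, so the random edges needed depend on the
  -- inserted vertices only.
  have hQJ : ∀ r ∈ Q, window k d r ⊆ J := by
    intro r hr j hj
    rw [hQ, Finset.mem_Ico] at hr
    rw [mem_window] at hj
    have h1 : t * d ≤ r * d := Nat.mul_le_mul_right _ hr.1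
    have h2 : (r + 1) * d ≤ 2 * t * d := Nat.mul_le_mul_right _ hr.2
    rw [add_mul, one_mul, mul_assoc] at h2
    rw [hJ, Finset.mem_Ico]
    omega
  set δ := β ^ (2 * t + (t * d - ℓ)) with hδ
  have hδ0 : 0 < δ := by positivity
  have hδ1 : δ ≤ 1 := pow_le_one₀ hβ0.le hβ1
  have hδk : β ^ (3 * k) ≤ δ := pow_le_pow_of_le_one hβ0.le hβ1 (by omega)
  set γ := δ / 2 with hγ
  set s := γ / (4 * (M + 1)) with hs
  have hγ0 : 0 < γ := by positivity
  have hs0 : 0 < s := by positivity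
  have hϑδ : ϑ * (36 * (k + 1) ^ 2) < δ := by
    rw [lt_div_iff₀ (by positivity)] at hϑ
    exact hϑ.trans_le hδk
  have hϑ1 : ϑ ≤ 1 := by nlinarith [sq_nonneg (k : ℝ), (Nat.cast_nonneg k : (0 : ℝ) ≤ k)]
  -- By choice of s, s(M + 1) = γ/4. Since M ≤ 3k, M²ϑ ≤ 9(k + 1)²ϑ < δ/4 = γ/2, which explains the
  -- constant 36 in `ϑ₀`.
  have hγs : s + M * (M * ϑ + s) < γ := by
    have h1 : s * (4 * (M + 1)) = γ := div_mul_cancel₀ _ (by positivity)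
    have h2 : (M : ℝ) * M ≤ (3 * k) * (3 * k) := by gcongr
    have h3 : (M : ℝ) * M * ϑ ≤ 9 * (k + 1) ^ 2 * ϑ := by
      refine mul_le_mul_of_nonneg_right (h2.trans ?_) hϑ0.le
      nlinarith [(Nat.cast_nonneg k : (0 : ℝ) ≤ k)]
    nlinarith
  -- c may be negative, while κ = n^c' has to be at least 1.
  set c' := max c 0 with hc'
  have hc't : c' * t < 1 := by
    rw [← lt_div_iff₀ ht0']
    exact max_lt hc (by positivity)
  have hev := (tendsto_rpow_pow_div hc't
    ((M + 1) * (2 ^ t * M ^ M) / s ^ 2)).eventually (gt_mem_nhds hε)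
  have hev2 := tendsto_natCast_atTop_atTop (R := ℝ) |>.eventually_ge_atTop (2 * M ^ 2 / δ)
  obtain ⟨n₀, hn₀⟩ := Filter.eventually_atTop.1
    (hev.and (hev2.and (Filter.eventually_gt_atTop 0)))
  refine ⟨n₀, ?_⟩
  intro n hn V _ _ H hHn Ps hPs hPsc hPath hPdisj hdeg p hp
  obtain ⟨hn1, hn2, hn0⟩ := hn₀ n hn
  have hn0' : (0 : ℝ) < n := by exact_mod_cast hn0
  have hn1' : (1 : ℝ) ≤ n := by exact_mod_cast hn0
  set κ := (n : ℝ) ^ c' with hκ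
  have hκ1 : 1 ≤ κ := Real.one_le_rpow hn1' (le_max_right _ _)
  have hp0 : 0 < (p : ℝ) := (Real.rpow_pos_of_pos hn0' _).trans_le hp
  have hdr : (k : ℝ) - ℓ = d := by rw [hd, Nat.cast_sub hℓk.le]
  have hpκ : 1 ≤ (p : ℝ) * n ^ d * κ := by
    calc (1 : ℝ) ≤ (n : ℝ) ^ (c' - c) := Real.one_le_rpow hn1' (sub_nonneg.2 (le_max_left _ _))
      _ = (n : ℝ) ^ (-((k : ℝ) - ℓ) - c) * n ^ d * κ := by
        rw [hκ, ← Real.rpow_natCast, ← Real.rpow_add hn0', ← Real.rpow_add hn0', hdr]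
        congr 1; ring
      _ ≤ _ := by gcongr
  set X := H.uncovered Ps with hX
  have hXH : X ⊆ H.verts := Finset.sdiff_subset
  obtain ⟨P, m, w, hPmem, hPseq, hPne, hPsurj⟩ := exists_enumeration Ps hPs fun P hP =>
    (hPath P hP).1
  set q := Ps.card with hq
  have hq0 : 0 < q := Finset.card_pos.2 hPs
  have hqn : q ≤ n := by
    have : (q : ℝ) ≤ n := hPsc.trans (mul_le_of_le_one_left hn0'.le hϑ1)
    exact_mod_cast this
  have hPX : ∀ i < q, Disjoint (P i).verts X := fun i hi => by
    rw [Finset.disjoint_left]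
    intro x hx hxX
    exact (Finset.mem_sdiff.1 hxX).2 (Finset.mem_biUnion.2 ⟨P i, hPmem i hi, hx⟩)
  have hdeg' : ∀ S ⊆ H.verts, S.card = ℓ → β * (n : ℝ) ^ d ≤ H.deg S X := fun S hS hSc =>
    (mul_le_mul_of_nonneg_right (min_le_left _ _) (by positivity)).trans (hdeg S hS hSc)
  have hwv : ∀ i < q, ∀ j < m i * d + ℓ, w i j ∈ H.verts := fun i hi j hj =>
    (hPath _ (hPmem i hi)).2.1 (by
      rw [(hPseq i hi).2.1]
      exact Finset.mem_image_of_mem _ (Finset.mem_range.2 hj))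
  have hwinj : ∀ i < q, Set.InjOn (w i) (Finset.range (m i * d + ℓ)) := fun i hi => (hPseq i hi).1
  obtain ⟨v₀, -⟩ : H.verts.Nonempty := Finset.card_pos.1 (by omega)
  have hnlarge : 2 * ((3 * t * d - ℓ : ℕ) : ℝ) ^ 2 ≤ β ^ (2 * t + (t * d - ℓ)) * n := by
    rw [← hM, ← hδ]
    rwa [div_le_iff₀ hδ0, mul_comm (n : ℝ)] at hn2
  have hF : ∀ i : ℕ, ∃ F ⊆ embeddings J H.verts v₀, i < q → (∀ f ∈ F, ∀ j ∈ J, f j ∈ X) ∧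
      (∀ f ∈ F, ∀ r ∈ Finset.range t ∪ Finset.Ico (2 * t) (3 * t), (window k d r).image
        (glue ℓ (3 * t * d) (fun j => w i (m i * d + j)) (w ((i + 1) % q)) f) ∈ H.edges) ∧
      γ * n ^ M ≤ F.card := by
    intro i
    by_cases hi : i < q
    swap
    · exact ⟨∅, Finset.empty_subset _, fun h => absurd h hi⟩
    have hi' : (i + 1) % q < q := Nat.mod_lt _ hq0
    obtain ⟨F, h1, h2, h3, h4⟩ := exists_connections (H := H) (X := X) (d := d) (ℓ := ℓ)
      (S := fun j => w i (m i * d + j)) (T := w ((i + 1) % q)) hd0 (by omega) ht0 htd v₀ hβ0 hHn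
      hn0 hXH hdeg'
      (fun a ha b hb h => by
        rw [Finset.mem_coe, Finset.mem_range] at ha hb
        have := hwinj i hi (x₁ := m i * d + a) (x₂ := m i * d + b) (by simpa using ha)
          (by simpa using hb) h
        omega)
      (fun x hx => by
        obtain ⟨j, hj, rfl⟩ := Finset.mem_image.1 hx
        exact hwv i hi _ (by rw [Finset.mem_range] at hj; omega))
      ((hwinj _ hi').mono fun j hj => by
        rw [Finset.mem_coe, Finset.mem_range] at hj ⊢; omega)
      (fun x hx => by
        obtain ⟨j, hj, rfl⟩ := Finset.mem_image.1 hx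
        exact hwv _ hi' _ (by rw [Finset.mem_range] at hj; omega))
      hnlarge
    exact ⟨F, h1, fun _ => ⟨h2, h3, h4⟩⟩
  choose F hFe hFX using hF
  -- ω = Mϑ because the sets to be avoided have at most qM ≤ Mϑn vertices.
  have hprob := le_prob_exists_avoiding (k := k) (d := d) (Q := Q) (J := J) (T := H.verts)
    (γ := γ) (s := s) (ω := M * ϑ) hd0 (by omega) hQJ (by omega) hHn hn0 v₀
    (H.nonEdges : Set (Finset V)) p hp0 hκ1 hpκ hqn (F := F) (fun i _ => hFe i) hs0
    (by rw [hJc]; exact hγs) (fun i hi => by rw [hJc]; exact (hFX i hi).2.2)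
  rw [hJc, hQc] at hprob
  have hbound : (M + 1) * (2 ^ t * (M : ℝ) ^ M) * κ ^ t / (s ^ 2 * n) < ε := by
    calc _ = (M + 1) * (2 ^ t * (M : ℝ) ^ M) / s ^ 2 * κ ^ t / n := by field_simp
      _ < ε := hn1
  refine le_trans (by linarith) (hprob.trans (MeasureTheory.measureReal_mono ?_))
  intro R hR
  have hR' : ∀ i < q, ∀ W ⊆ H.verts, (W.card : ℝ) ≤ M * ϑ * n → ∃ g ∈ F i, (∀ j ∈ J, g j ∉ W) ∧
    ∀ e ∈ windowEdges k d Q g, presence (H.nonEdges : Set (Finset V)) p R e ≠ 0 := hR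
  have hHG : H.edges ⊆ (H.perturb R).edges := Finset.subset_union_left
  obtain ⟨C, hC, hCG, hCX, hCP⟩ := KGraph.exists_cycle_of_connections (G := H.perturb R) (X := X)
    (P := P) (m := m) (w := w) hq0 hℓk ht0 htd hPseq
    (fun i hi => ⟨(hPath _ (hPmem i hi)).2.1, (hPath _ (hPmem i hi)).2.2.trans hHG⟩) hXH
    (fun i hi i' hi' hne => hPdisj _ (hPmem i hi) _ (hPmem i' hi') (hPne i hi i' hi' hne)) hPX
    (fun i hi W hW hWc => by
      have hWc' : (W.card : ℝ) ≤ M * ϑ * n := by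
        calc (W.card : ℝ) ≤ q * M := by exact_mod_cast hWc
          _ ≤ (ϑ * n) * M := by gcongr
          _ = _ := by ring
      obtain ⟨g, hg, hgW, hgp⟩ := hR' i hi W (hW.trans hXH) hWc'
      have hgJ := mem_embeddings.1 (hFe i hg)
      refine ⟨g, fun j hj => ⟨(hFX i hi).1 g hg j hj, hgW j hj⟩, hgJ.2, fun r hr => ?_⟩
      -- A middle window has positive weight, hence its image is an edge of H or a random edge; the
      -- other windows are edges of H by construction.
      by_cases hrQ : r ∈ Q
      · have hwin : (window k d r).image
            (glue ℓ (3 * t * d) (fun j => w i (m i * d + j)) (w ((i + 1) % q)) g)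
            = (window k d r).image g := by
          refine Finset.image_congr fun j hj => ?_
          have := Finset.mem_Ico.1 (hQJ r hrQ hj)
          rw [glue, if_neg (by omega), if_pos (by omega)]
        rw [← hd, hwin]
        refine mem_perturb_edges ?_ (fun y hy => ?_) fun h => mem_of_presence_ne_zero
          (hgp _ (Finset.mem_image_of_mem _ hrQ)) h
        · rw [Finset.card_image_of_injOn (hgJ.2.mono (Finset.coe_subset.2 (hQJ r hrQ))),
            card_window]
        · obtain ⟨j, hj, rfl⟩ := Finset.mem_image.1 hy
          exact (mem_mapsInto.1 hgJ.1).1 j (hQJ r hrQ hj)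
      · refine hHG ((hFX i hi).2.1 g hg r ?_)
        rw [hQ, Finset.mem_Ico] at hrQ
        simp only [Finset.mem_union, Finset.mem_range, Finset.mem_Ico]
        omega)
  refine ⟨C, hC, hCG, hCX.trans ?_, fun P' hP' => ?_⟩
  · rw [← hd, ← hM, mul_comm]
    exact Nat.mul_le_mul_right _ (by omega)
  · obtain ⟨i, hi, rfl⟩ := hPsurj P' hP'
    exact hCP i hi
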